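/- Let $f_i:\mathbb{R}^{R\times n_i}\times\mathbb{R}^{L\times R}\to\mathbb{R}$, $g_i:\mathbb{R}^{R\times n_i}\to(-\infty,+\infty]$ ($i=1,\dots,N$) and $r:\mathbb{R}^{L\times R}\to(-\infty,+\infty]$, and for $A=(A_1,\dots,A_N)$ put $$F(A,M)=\sum_{i=1}^N f_i(A_i,M),\qquad \Psi(A,M)=F(A,M)+\sum_{i=1}^N g_i(A_i)+r(M).$$ **Assumptions on the problem.** (a) The $g_i$ and $r$ are proper, convex, lower semicontinuous; (b) each $f_i$ is $\mathcal{C}^1$ and convex in each of its two variables when the other is fixed; (c) $\Psi$, $f_i$, $g_i$, $r$ are bounded below; (d) $\Psi$ is coercive and semi-algebraic; (e) $\nabla_{A_i}f_i(\cdot,M)$ is Lipschitz with constant $L_{A_i}(M)$, each $\nabla_M f_i(A_i,\cdot)$ is Lipschitz, $\nabla_M F(A,\cdot)$ is Lipschitz with constant $L_M(A)$, and $\nabla_{A_i}f_i(A_i,\cdot)$ is Lipschitz with constant $L_{A_i,M}(A_i)$; (f) $\nabla F$ is Lipschitz on bounded sets. **Algorithm.** Let $\gamma_0\in(0,1]$,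 $\mu\in(0,1)$, $\gamma_{k+1}=\gamma_k(1-\mu\gamma_k)$, and let $(A^0,M^0)$ be a deterministic point with $g_i(A_i^0)<\infty$ for all $i$ and $r(M^0)<\infty$. Write $\operatorname{prox}_{c\,h}(z)=\operatorname{argmin}_u\{h(u)+\tfrac c2\|u-z\|^2\}$ (Frobenius norm). At iteration $k\ge 0$, given a worker $\omega^k\in\{1,\dots,N\}$ and a delay $d^k\in\mathbb{N}$, set $\tilde M^k=M^{k-d^k}$ (with $M^q=M^0$ for $q<0$), $$\hat A^k\in\operatorname{prox}_{c_A^k g_{\omega^k}}\Bigl(A^k_{\omega^k}-\tfrac1{c_A^k}\nabla_{A_{\omega^k}}f_{\omega^k}(A^k_{\omega^k},\tilde M^k)\Bigr),\quad A^{k+1}_{\omega^k}=A^k_{\omega^k}+\gamma_k(\hat A^k-A^k_{\omega^k}),\quad A^{k+1}_i=A^k_i\ (i\ne\omega^k),$$ $$\hat M^k\in\operatorname{prox}_{c_M^k r}\Bigl(M^k-\tfrac1{c_M^k}\nabla_M F(A^{k+1},M^k)\Bigr),\quad M^{k+1}=M^k+\gamma_k(\hat M^k-M^k),$$ with $c_A^k=L_{A_{\omega^k}}(\tilde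 M^k)$ and $c_M^k=L_M(A^{k+1})$. **Random workers and delays.** The pairs $(\omega^k,d^k)_{k\ge 0}$ form a stochastic process on a probability space such that almost surely $d^k\le\tau$ for all $k$, for a constant $\tau\in\mathbb{N}^*$, and such that, for some $T\in\mathbb{N}$ and $p_{\min}>0$, almost surely for every $k$ and every worker $i$ there is $t\in\{0,\dots,T\}$ for which the conditional probability of $\omega^{k+t}=i$, given the values of $(\omega^j,d^j)_{j<k+t}$, is at least $p_{\min}$. **Bounded constants.** Almost surely, each of the sequences $L_{A_{\omega^k}}(\tilde M^k)$, $L_M(A^{k+1})$ and $L_{A_{\omega^k},M}(A^k_{\omega^k})$, $k\in\mathbb{N}$, is bounded above, and bounded below by a positive number. Under these assumptions the iterates $v^k=(A^k,M^k)$ satisfy: (i) almost surely, $\Psi(v^k)$ converges to a (finite) real number; (ii) almost surely, every limit point of $(v^k)_{k\in\mathbb{N}}$ is a critical point of $\Psi$, i.e. a point $v$ with $0\in\partial\Psi(v)$, where $\partial\Psi$ is the limiting subdifferential. -/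

import Mathlib

open Filter Topology MeasureTheory ProbabilityTheory
open scoped NNReal ENNReal

namespace AsyncUnmixing

noncomputable section

/-! ### Spaces -/

/-- Real `m × n` matrices with the Frobenius norm and inner product. -/
abbrev RMat (m n : ℕ) : Type := EuclideanSpace ℝ (Fin m × Fin n)

/-- The local variables `A = (A_i)_i`, one `R × n i` matrix for each of the `N` workers. -/
abbrev Locals {N : ℕ} (R : ℕ) (n : Fin N → ℕ) : Type := PiLp 2 (fun i => RMat R (n i))

/-- The pairs `v = (A, M)` of local variables and shared variable, with the Euclidean norm. -/
abbrev Joint {N : ℕ} (L R : ℕ) (n : Fin N → ℕ) : Type := WithLp 2 (Locals R n × RMat L R)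

/-! ### Objective -/

section Objective

variable {N L R : ℕ} {n : Fin N → ℕ}

/-- `F(A, M) = ∑ i, f_i(A_i, M)`. -/
def coupling (f : ∀ i, RMat R (n i) → RMat L R → ℝ) (A : Locals R n) (M : RMat L R) : ℝ :=
  ∑ i, f i (A i) M

/-- `Ψ(A, M) = F(A, M) + ∑ i, g_i(A_i) + r(M)`, with values in the extended reals. -/
def objective (f : ∀ i, RMat R (n i) → RMat L R → ℝ) (g : ∀ i, RMat R (n i) → EReal)
    (r : RMat L R → EReal) (v : Joint L R n) : EReal :=
  ((coupling f v.fst v.snd : ℝ) : EReal) + ∑ i, g i (v.fst i) + r v.snd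

end Objective

/-! ### Extended-real valued functions -/

section Convex

variable {E : Type*} [NormedAddCommGroup E] [InnerProductSpace ℝ E]

/-- Proper, convex, lower semicontinuous functions with values in `(-∞, +∞]`. -/
structure IsProperConvexLSC (h : E → EReal) : Prop where
  ne_bot : ∀ x, h x ≠ ⊥
  proper : ∃ x, h x ≠ ⊤
  convex : ∀ x y : E, ∀ a b : ℝ, 0 ≤ a → 0 ≤ b → a + b = 1 →
    h (a • x + b • y) ≤ (a : EReal) * h x + (b : EReal) * h y
  lsc : LowerSemicontinuous h

/-- `u ∈ argmin_w { h(w) + (c / 2) ‖w - z‖² }`, i.e. `u` is a value at `z` of the proximal map of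
`h` with parameter `c`. -/
def IsProx (c : ℝ) (h : E → EReal) (z u : E) : Prop :=
  ∀ w, h u + ((c / 2 * ‖u - z‖ ^ 2 : ℝ) : EReal) ≤ h w + ((c / 2 * ‖w - z‖ ^ 2 : ℝ) : EReal)

/-- `u` is a Fréchet subgradient of `h` at `x`: `h x` is finite and
`liminf_{y → x, y ≠ x} (h y - h x - ⟪u, y - x⟫) / ‖y - x‖ ≥ 0`. -/
def IsFrechetSubgradient (h : E → EReal) (x u : E) : Prop :=
  h x ≠ ⊥ ∧ h x ≠ ⊤ ∧ ∀ ε : ℝ, 0 < ε →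
    ∀ᶠ y in 𝓝 x, h x + ((inner ℝ u (y - x) - ε * ‖y - x‖ : ℝ) : EReal) ≤ h y

/-- `u` belongs to the limiting subdifferential of `h` at `x`. -/
def IsLimitingSubgradient (h : E → EReal) (x u : E) : Prop :=
  h x ≠ ⊥ ∧ h x ≠ ⊤ ∧ ∃ (y s : ℕ → E), Tendsto y atTop (𝓝 x) ∧
    Tendsto (fun j => h (y j)) atTop (𝓝 (h x)) ∧
    (∀ j, IsFrechetSubgradient h (y j) (s j)) ∧ Tendsto s atTop (𝓝 u)

/-- Critical points: `0` is a limiting subgradient. -/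
def IsCriticalPoint (h : E → EReal) (x : E) : Prop := IsLimitingSubgradient h x 0

end Convex

/-! ### Semi-algebraic functions -/

/-- Semi-algebraic subsets of `ℝ^m`: `⋃ j, ⋂ i, {u | p_{ji}(u) = 0, q_{ji}(u) < 0}` (finite union
and intersection) with real polynomials `p_{ji}`, `q_{ji}`. -/
def IsSemialgebraicCoord {m : ℕ} (S : Set (Fin m → ℝ)) : Prop :=
  ∃ (a b : ℕ) (p q : Fin a → Fin b → MvPolynomial (Fin m) ℝ),
    S = {u | ∃ j, ∀ i, MvPolynomial.eval u (p j i) = 0 ∧ MvPolynomial.eval u (q j i) < 0}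

/-- Semi-algebraic subsets of a finite-dimensional real vector space, through linear coordinates
(the notion does not depend on the coordinates). -/
def IsSemialgebraicSet {E : Type*} [AddCommGroup E] [Module ℝ E] (S : Set E) : Prop :=
  ∃ (m : ℕ) (e : E ≃ₗ[ℝ] (Fin m → ℝ)), IsSemialgebraicCoord (e '' S)

/-- An extended-real valued function is semi-algebraic if the graph `{(x, t) | h x = t}`, `t` real,
is a semi-algebraic set. -/
def IsSemialgebraicFun {E : Type*} [AddCommGroup E] [Module ℝ E] (h : E → EReal) : Prop :=
  IsSemialgebraicSet {p : E × ℝ | h p.1 = (p.2 : EReal)}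

/-! ### Assumptions on the problem -/

/-- Regularity of the problem. `LA i M` is a Lipschitz constant of `∇_{A_i} f_i(·, M)` and `LM A`
a Lipschitz constant of `∇_M F(A, ·)`. -/
structure PALMAssumptions {N L R : ℕ} {n : Fin N → ℕ}
    (f : ∀ i, RMat R (n i) → RMat L R → ℝ) (g : ∀ i, RMat R (n i) → EReal)
    (r : RMat L R → EReal)
    (LA : Fin N → RMat L R → ℝ≥0) (LM : Locals R n → ℝ≥0) : Prop where
  g_convex : ∀ i, IsProperConvexLSC (g i)
  r_convex : IsProperConvexLSC r
  f_contDiff : ∀ i, ContDiff ℝ 1 (fun p : RMat R (n i) × RMat L R => f i p.1 p.2)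
  f_convex_left : ∀ i M, ConvexOn ℝ Set.univ (fun X => f i X M)
  f_convex_right : ∀ i X, ConvexOn ℝ Set.univ (fun M => f i X M)
  objective_lower : ∃ b : ℝ, ∀ v, (b : EReal) ≤ objective f g r v
  f_lower : ∀ i, ∃ b : ℝ, ∀ X M, b ≤ f i X M
  g_lower : ∀ i, ∃ b : ℝ, ∀ X, (b : EReal) ≤ g i X
  r_lower : ∃ b : ℝ, ∀ M, (b : EReal) ≤ r M
  coercive : Tendsto (objective f g r) (Bornology.cobounded (Joint L R n)) (𝓝 ⊤)
  semialgebraic : IsSemialgebraicFun (objective f g r)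
  lipschitz_left : ∀ i M, LipschitzWith (LA i M) (fun X => gradient (fun X' => f i X' M) X)
  lipschitz_right : ∀ i X, ∃ K : ℝ≥0, LipschitzWith K (fun M => gradient (fun M' => f i X M') M)
  lipschitz_shared : ∀ A, LipschitzWith (LM A) (fun M => gradient (fun M' => coupling f A M') M)
  lipschitz_bounded : ∀ B : Set (Joint L R n), Bornology.IsBounded B →
    ∃ K : ℝ≥0, LipschitzOnWith K
      (fun v => gradient (fun v' : Joint L R n => coupling f v'.fst v'.snd) v) B

/-! ### Random selection of workers and delays -/

section Delays

variable {Ω : Type*} {N : ℕ}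

/-- The event that the worker/delay pairs of the iterations `0, …, k - 1` are those of the
outcome `x`. -/
def history (w : ℕ → Ω → Fin N) (d : ℕ → Ω → ℕ) (k : ℕ) (x : Ω) : Set Ω :=
  {y | ∀ j < k, w j y = w j x ∧ d j y = d j x}

/-- The probabilistic model of the selected workers `w k` and delays `d k`: a discrete-time process
of pairs with bounded delays, such that, given the past, each worker has within every window of
`T + 1` iterations an iteration at which it is selected with conditional probability at least
`pmin > 0`. (`P[|H]` is `P` conditioned on the event `H`.) -/
structure DelayModel [MeasurableSpace Ω] (P : Measure Ω) (w : ℕ → Ω → Fin N) (d : ℕ → Ω → ℕ) :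
    Prop where
  measurable_worker : ∀ k, Measurable (w k)
  measurable_delay : ∀ k, Measurable (d k)
  bounded_delay : ∃ τ : ℕ, 0 < τ ∧ ∀ᵐ x ∂P, ∀ k, d k x ≤ τ
  selection : ∃ (T : ℕ) (pmin : ℝ), 0 < pmin ∧ ∀ᵐ x ∂P, ∀ (k : ℕ) (i : Fin N),
    ∃ t ≤ T, pmin ≤ (P[|history w d (k + t) x]).real {y | w (k + t) y = i}

end Delays

/-! ### The algorithm -/

/-- `(A k, M k)` are the iterates of the partially asynchronous algorithm (one worker per iteration)
along a sequence of workers `w` and delays `d`, with relaxation parameters `γ`, and step-size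
parameters `cA k` (selected worker) and `cM k` (master), started from `(A0, M0)`.
The delayed shared variable is `M (k - d k)`, with `M q = M 0` for `q < 0`
(natural-number subtraction). -/
structure IsRun {N L R : ℕ} {n : Fin N → ℕ}
    (f : ∀ i, RMat R (n i) → RMat L R → ℝ) (g : ∀ i, RMat R (n i) → EReal)
    (r : RMat L R → EReal) (γ : ℕ → ℝ) (cA cM : ℕ → ℝ) (A0 : Locals R n) (M0 : RMat L R)
    (w : ℕ → Fin N) (d : ℕ → ℕ) (A : ℕ → Locals R n) (M : ℕ → RMat L R) : Prop where
  init_local : A 0 = A0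
  init_shared : M 0 = M0
  worker : ∀ k, ∃ Ahat : RMat R (n (w k)),
    IsProx (cA k) (g (w k))
      (A k (w k) - (cA k)⁻¹ • gradient (fun X => f (w k) X (M (k - d k))) (A k (w k))) Ahat ∧
    A (k + 1) (w k) = A k (w k) + γ k • (Ahat - A k (w k))
  idle : ∀ k i, i ≠ w k → A (k + 1) i = A k i
  master : ∀ k, ∃ Mhat : RMat L R,
    IsProx (cM k) r
      (M k - (cM k)⁻¹ • gradient (fun X => coupling f (A (k + 1)) X) (M k)) Mhat ∧
    M (k + 1) = M k + γ k • (Mhat - M k)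

end

end AsyncUnmixing

open AsyncUnmixing

/-!
The proof is pathwise, apart from one martingale argument.

*Descent.* The optimality condition of the proximal map (`IsProx.subgradient`), together with
convexity of the smooth part used at the end point of a step, gives a decrease of the objective by
about `γ k` times the squared step lengths, the "energy" of iteration `k`, up to an error due to the
delay (`IsProx.step_decrease`, `IsTrajectory.step`). Working at the end point matters: it only
requires the Lipschitz constants that are assumed bounded along the trajectory, since
`LAM (A (k + 1) (w k))` reappears when the same worker is selected again. As `γ k → 0`, the delay
errors are eventually dominated by the decrease, and a Lyapunov function that records the last `τ`
updates (`summable_and_tendsto_of_delayed_descent`) shows that the objective converges and that the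
energies are summable. No a priori bound on the iterates is needed.

*Cluster points.* If the optimality condition of a block fails at a cluster point, then, by lower
semicontinuity, all proximal steps of that block taken near the point have lengths bounded below
(`exists_le_norm_prox_sub`), so the total weight `∑ γ k` of these steps near the point is finite. If
the block is updated in a fixed proportion of the `γ`-time, the sequence then spends arbitrarily
little `γ`-time near the point after a late visit, hence moves too little to leave; as `∑ γ k = ∞`,
this is absurd (`not_mapClusterPt_of_summable_near`). Therefore every cluster point satisfies all
the block conditions, and zero is a Fréchet subgradient of the objective there
(`PALMAssumptions.isCriticalPoint`).

*Selection.* That worker `i` is selected in a fixed proportion of the `γ`-time follows from the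
almost sure convergence of the martingale `∑ γ k (1_{w k = i} - P(w k = i | past))`, which is bounded
in `L²` because `∑ γ k ^ 2 < ∞` (`DelayModel.ae_tendsto_sum`). The same fact shows that every worker
is selected infinitely often.
-/

namespace AsyncUnmixing

/-! ### Proximal steps on extended-real valued convex functions -/

section Prox

variable {E : Type*} [NormedAddCommGroup E] [InnerProductSpace ℝ E]

theorem IsProperConvexLSC.segment {h : E → EReal} (hh : IsProperConvexLSC h) {x y : E}
    (hx : h x ≠ ⊤) (hy : h y ≠ ⊤) {t : ℝ} (ht0 : 0 ≤ t) (ht1 : t ≤ 1) :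
    h (x + t • (y - x)) ≠ ⊤ ∧
      (h (x + t • (y - x))).toReal ≤ (1 - t) * (h x).toReal + t * (h y).toReal := by
  have hc := hh.convex x y (1 - t) t (by linarith) ht0 (by ring)
  have hxy : (1 - t) • x + t • y = x + t • (y - x) := by module
  rw [hxy, ← EReal.coe_toReal hx (hh.ne_bot x), ← EReal.coe_toReal hy (hh.ne_bot y),
    ← EReal.coe_mul, ← EReal.coe_mul, ← EReal.coe_add] at hc
  have hfin : h (x + t • (y - x)) ≠ ⊤ := ne_top_of_le_ne_top (EReal.coe_ne_top _) hc
  refine ⟨hfin, ?_⟩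
  rw [← EReal.coe_toReal hfin (hh.ne_bot _), EReal.coe_le_coe_iff] at hc
  exact hc

theorem IsProx.ne_top {h : E → EReal} (hh : IsProperConvexLSC h) {c : ℝ} {z u : E}
    (hp : IsProx c h z u) : h u ≠ ⊤ := by
  obtain ⟨w, hw⟩ := hh.proper
  intro hu
  have := hp w
  rw [hu, EReal.top_add_coe, ← EReal.coe_toReal hw (hh.ne_bot w), ← EReal.coe_add] at this
  exact EReal.coe_ne_top _ (top_le_iff.mp this)

/-- The optimality condition of the proximal map: `c • (z - u)` is a (convex) subgradient of `h`
at `u`. -/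
theorem IsProx.subgradient {h : E → EReal} (hh : IsProperConvexLSC h) {c : ℝ} {z u : E}
    (hp : IsProx c h z u) {w : E} (hw : h w ≠ ⊤) :
    (h u).toReal + c * inner ℝ (z - u) (w - u) ≤ (h w).toReal := by
  have hu := hp.ne_top hh
  -- Compare `u` with the points `u + t • (w - u)` and let `t` tend to zero.
  have key : ∀ t : ℝ, 0 < t → t ≤ 1 →
      (h u).toReal + c * inner ℝ (z - u) (w - u) - (h w).toReal ≤ t * (c / 2 * ‖w - u‖ ^ 2) := by
    intro t ht0 ht1
    obtain ⟨hs, hs'⟩ := hh.segment hu hw ht0.le ht1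
    have hq := hp (u + t • (w - u))
    rw [← EReal.coe_toReal hu (hh.ne_bot _), ← EReal.coe_toReal hs (hh.ne_bot _),
      ← EReal.coe_add, ← EReal.coe_add, EReal.coe_le_coe_iff] at hq
    have hn : ‖u + t • (w - u) - z‖ ^ 2
        = ‖u - z‖ ^ 2 - 2 * t * inner ℝ (z - u) (w - u) + t ^ 2 * ‖w - u‖ ^ 2 := by
      have : u + t • (w - u) - z = (u - z) + t • (w - u) := by abel
      rw [this, norm_add_sq_real, inner_smul_right, norm_smul, mul_pow, Real.norm_eq_abs, sq_abs,
        ← neg_sub z u, inner_neg_left, norm_neg]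
      ring
    rw [hn] at hq
    have : t * ((h u).toReal + c * inner ℝ (z - u) (w - u) - (h w).toReal)
        ≤ t * (t * (c / 2 * ‖w - u‖ ^ 2)) := by nlinarith
    exact le_of_mul_le_mul_left this ht0
  have hlim : Tendsto (fun t : ℝ => t * (c / 2 * ‖w - u‖ ^ 2)) (𝓝[>] 0) (𝓝 0) := by
    have : Tendsto (fun t : ℝ => t * (c / 2 * ‖w - u‖ ^ 2)) (𝓝 0)
        (𝓝 (0 * (c / 2 * ‖w - u‖ ^ 2))) := tendsto_id.mul_const _
    rw [zero_mul] at this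
    exact this.mono_left nhdsWithin_le_nhds
  have h0 := ge_of_tendsto (b := (h u).toReal + c * inner ℝ (z - u) (w - u) - (h w).toReal) hlim (by
    filter_upwards [Ioc_mem_nhdsGT (zero_lt_one' ℝ)] with t ht using key t ht.1 ht.2)
  linarith

theorem ConvexOn.le_add_inner_gradient [CompleteSpace E] {φ : E → ℝ}
    (hφ : ConvexOn ℝ Set.univ φ) {x y : E} (hd : DifferentiableAt ℝ φ y) :
    φ y ≤ φ x + inner ℝ (gradient φ y) (y - x) := by
  -- Restrict `φ` to the line through `y` and `x`.
  have hline : HasDerivAt (fun t : ℝ => φ (AffineMap.lineMap y x t)) (fderiv ℝ φ y (x - y)) 0 := by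
    have h1 : HasDerivAt (fun t : ℝ => AffineMap.lineMap y x t) (x - y) (0 : ℝ) :=
      AffineMap.hasDerivAt_lineMap
    have h2 : HasFDerivAt φ (fderiv ℝ φ y) (AffineMap.lineMap y x (0 : ℝ)) := by
      rw [AffineMap.lineMap_apply_zero]; exact hd.hasFDerivAt
    exact h2.comp_hasDerivAt 0 h1
  have hconv : ConvexOn ℝ Set.univ (fun t : ℝ => φ (AffineMap.lineMap y x t)) := by
    exact hφ.comp_affineMap (AffineMap.lineMap (k := ℝ) y x)
  have hs := hconv.le_slope_of_hasDerivAt (Set.mem_univ _) (Set.mem_univ (1 : ℝ)) zero_lt_one hline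
  rw [slope_def_field, AffineMap.lineMap_apply_zero, AffineMap.lineMap_apply_one] at hs
  have hg : inner ℝ (gradient φ y) (y - x) = - fderiv ℝ φ y (x - y) := by
    rw [gradient, InnerProductSpace.toDual_symm_apply, ← map_neg, neg_sub]
  rw [hg]
  linarith

/-- Decrease of `φ + h` along a relaxed proximal gradient step that uses an approximation `G` of
`∇φ(x)`. Convexity of `φ` lets one compare with the gradient at the end point `y`, so that no
descent lemma, hence no Lipschitz constant of `∇φ` itself, is needed. -/
theorem IsProx.step_decrease [CompleteSpace E] {h : E → EReal} (hh : IsProperConvexLSC h)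
    {φ : E → ℝ} (hφ : ConvexOn ℝ Set.univ φ) {c γ e : ℝ} (hc : 0 < c) (hγ0 : 0 ≤ γ) (hγ1 : γ ≤ 1)
    {x G u y : E} (hd : DifferentiableAt ℝ φ y) (hx : h x ≠ ⊤)
    (hp : IsProx c h (x - c⁻¹ • G) u) (hy : y = x + γ • (u - x))
    (hG : ‖gradient φ y - G‖ ≤ c * ‖y - x‖ + e) :
    h y ≠ ⊤ ∧ φ y + (h y).toReal ≤
      φ x + (h x).toReal - c * γ * (1 - γ) * ‖u - x‖ ^ 2 + e * (γ * ‖u - x‖) := by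
  have hu := hp.ne_top hh
  obtain ⟨hs, hs'⟩ := hh.segment hx hu hγ0 hγ1
  rw [← hy] at hs hs'
  refine ⟨hs, ?_⟩
  have h1 := hp.subgradient hh hx
  have hyx : y - x = γ • (u - x) := by rw [hy]; abel
  have hnorm : ‖y - x‖ = γ * ‖u - x‖ := by
    rw [hyx, norm_smul, Real.norm_eq_abs, abs_of_nonneg hγ0]
  have h2 : c * inner ℝ (x - c⁻¹ • G - u) (x - u) = c * ‖u - x‖ ^ 2 + inner ℝ G (u - x) := by
    have : x - c⁻¹ • G - u = (x - u) - c⁻¹ • G := by abel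
    rw [this, inner_sub_left, real_inner_self_eq_norm_sq, inner_smul_left, ← neg_sub u x,
      inner_neg_right, norm_neg]
    simp
    field_simp
  have h3 := ConvexOn.le_add_inner_gradient hφ (x := x) hd
  have h4 : inner ℝ (gradient φ y) (y - x)
      = inner ℝ (gradient φ y - G) (y - x) + γ * inner ℝ G (u - x) := by
    rw [inner_sub_left, ← inner_smul_right, ← hyx]; ring
  have h5 : inner ℝ (gradient φ y - G) (y - x) ≤ (c * ‖y - x‖ + e) * ‖y - x‖ :=
    (real_inner_le_norm _ _).trans (by gcongr)
  rw [h2] at h1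
  rw [h4] at h3
  rw [hnorm] at h5
  nlinarith

/-- If `-G'` is not a subgradient of `h` at `x'`, then proximal gradient steps from points near
`x'` with gradients near `G'` have lengths bounded away from zero. -/
theorem exists_le_norm_prox_sub {h : E → EReal} (hh : IsProperConvexLSC h) {x' G' : E} {H : ℝ}
    (hns : ∃ w, ¬ h x' + ((inner ℝ (-G') (w - x') : ℝ) : EReal) ≤ h w) :
    ∃ δ > 0, ∀ (x G u : E) (c : ℝ), dist x x' < δ → dist G G' < δ → 0 < c → c ≤ H →
      IsProx c h (x - c⁻¹ • G) u → δ ≤ ‖u - x‖ := by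
  obtain ⟨w, hw⟩ := hns
  rw [not_le] at hw
  have hwt : h w ≠ ⊤ := hw.ne_top
  set a := (h w).toReal with ha
  rw [← EReal.coe_toReal hwt (hh.ne_bot w), ← ha] at hw
  have hlt : ((a + inner ℝ G' (w - x') : ℝ) : EReal) < h x' := by
    by_cases hx' : h x' = ⊤
    · rw [hx']; exact EReal.coe_lt_top _
    · rw [← EReal.coe_toReal hx' (hh.ne_bot _), ← EReal.coe_add, EReal.coe_lt_coe_iff,
        inner_neg_left] at hw
      rw [← EReal.coe_toReal hx' (hh.ne_bot _), EReal.coe_lt_coe_iff]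
      linarith
  obtain ⟨b, hb1, hb2⟩ := EReal.lt_iff_exists_real_btwn.mp hlt
  rw [EReal.coe_lt_coe_iff] at hb1
  -- An upper bound for `h u` at any proximal step `x ↦ u` with data `G`, `c ≤ H`.
  have hcont : ContinuousAt (fun p : E × E × E =>
      a + H * (‖p.2.2 - p.1‖ * ‖w - p.2.2‖) + inner ℝ p.2.1 (w - p.2.2)) (x', G', x') := by
    fun_prop
  have hev1 := hcont.eventually_lt (continuousAt_const (y := b)) (by simpa using hb1)
  have hlast : Tendsto (fun p : E × E × E => p.2.2) (𝓝 (x', G', x')) (𝓝 x') :=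
    Continuous.tendsto' (by fun_prop) _ _ rfl
  have hev2 : ∀ᶠ p : E × E × E in 𝓝 (x', G', x'), (b : EReal) < h p.2.2 :=
    hlast.eventually (hh.lsc x' _ hb2)
  obtain ⟨ε, hε, hball⟩ := Metric.eventually_nhds_iff.mp (hev1.and hev2)
  refine ⟨ε / 2, half_pos hε, fun x G u c hx hG hc hcH hp => ?_⟩
  by_contra! hux
  have hu' : dist u x' < ε := by
    have := dist_triangle u x x'
    rw [dist_eq_norm u x] at this
    linarith
  obtain ⟨h1, h2⟩ := @hball (x, G, u) (by
    simp only [Prod.dist_eq, max_lt_iff]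
    exact ⟨by linarith, by linarith, hu'⟩)
  dsimp only at h1 h2
  have hut := hp.ne_top hh
  rw [← EReal.coe_toReal hut (hh.ne_bot _), EReal.coe_lt_coe_iff] at h2
  have h3 := hp.subgradient hh hwt
  have h4 : c * inner ℝ (x - c⁻¹ • G - u) (w - u)
      = - (c * inner ℝ (u - x) (w - u)) - inner ℝ G (w - u) := by
    have : x - c⁻¹ • G - u = -(u - x) - c⁻¹ • G := by abel
    rw [this, inner_sub_left, inner_smul_left, inner_neg_left]
    simp
    field_simp
  have h5 : c * inner ℝ (u - x) (w - u) ≤ H * (‖u - x‖ * ‖w - u‖) :=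
    (mul_le_mul_of_nonneg_left (real_inner_le_norm _ _) hc.le).trans (by gcongr)
  linarith

end Prox

/-! ### Real sequences: relaxation parameters, delayed descent, cluster points -/

section Relaxation

variable {γ : ℕ → ℝ} {μ : ℝ}

theorem relaxation_pos_le_one (hγ0 : 0 < γ 0) (hγ0' : γ 0 ≤ 1) (hμ0 : 0 < μ) (hμ1 : μ < 1)
    (hγ : ∀ k, γ (k + 1) = γ k * (1 - μ * γ k)) (k : ℕ) : 0 < γ k ∧ γ k ≤ 1 := by
  induction k with
  | zero => exact ⟨hγ0, hγ0'⟩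
  | succ k ih =>
    obtain ⟨h0, h1⟩ := ih
    have h2 : 0 < 1 - μ * γ k := by nlinarith
    have h3 : 1 - μ * γ k ≤ 1 := by nlinarith
    rw [hγ]
    exact ⟨mul_pos h0 h2, mul_le_one₀ h1 h2.le h3⟩

theorem relaxation_antitone (hpos : ∀ k, 0 < γ k) (hμ0 : 0 < μ)
    (hγ : ∀ k, γ (k + 1) = γ k * (1 - μ * γ k)) : Antitone γ :=
  antitone_nat_of_succ_le fun k => by
    rw [hγ]
    nlinarith [mul_pos hμ0 (mul_pos (hpos k) (hpos k))]

theorem relaxation_sub_eq_sum (hγ : ∀ k, γ (k + 1) = γ k * (1 - μ * γ k)) (m n : ℕ) :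
    γ m - γ (m + n) = ∑ k ∈ Finset.range n, μ * γ (m + k) ^ 2 := by
  induction n with
  | zero => simp
  | succ n ih =>
    rw [Finset.sum_range_succ, ← ih, ← add_assoc, hγ]
    ring

theorem relaxation_summable_sq (hpos : ∀ k, 0 < γ k) (hμ0 : 0 < μ)
    (hγ : ∀ k, γ (k + 1) = γ k * (1 - μ * γ k)) : Summable fun k => γ k ^ 2 := by
  refine summable_of_sum_range_le (c := γ 0 / μ) (fun k => sq_nonneg _) fun n => ?_
  have h := relaxation_sub_eq_sum hγ 0 n
  simp only [zero_add, ← Finset.mul_sum] at h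
  rw [le_div_iff₀ hμ0]
  nlinarith [hpos n]

/-- By telescoping, every tail of `∑ γ k` is at least `1 / μ`. -/
theorem relaxation_not_summable (hpos : ∀ k, 0 < γ k) (hμ0 : 0 < μ)
    (hγ : ∀ k, γ (k + 1) = γ k * (1 - μ * γ k)) : ¬ Summable γ := by
  intro hs
  have hanti := relaxation_antitone hpos hμ0 hγ
  have hzero : Tendsto γ atTop (𝓝 0) := hs.tendsto_atTop_zero
  have htail : ∀ m, 1 ≤ μ * ∑' k, γ (k + m) := by
    intro m
    have hsm : Summable fun k => γ (k + m) := (summable_nat_add_iff m).mpr hs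
    have hn : ∀ n, γ m - γ (m + n) ≤ γ m * (μ * ∑' k, γ (k + m)) := by
      intro n
      rw [relaxation_sub_eq_sum hγ]
      calc ∑ k ∈ Finset.range n, μ * γ (m + k) ^ 2
          ≤ ∑ k ∈ Finset.range n, γ m * (μ * γ (k + m)) := by
            refine Finset.sum_le_sum fun k _ => ?_
            rw [add_comm k m]
            have := hanti (Nat.le_add_right m k)
            have h2 := mul_le_mul_of_nonneg_right this (mul_pos hμ0 (hpos (m + k))).le
            nlinarith
        _ = γ m * (μ * ∑ k ∈ Finset.range n, γ (k + m)) := by simp only [Finset.mul_sum]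
        _ ≤ _ := by
            have := hsm.sum_le_tsum (Finset.range n) (fun k _ => (hpos (k + m)).le)
            have := hpos m
            gcongr
    have hlim : Tendsto (fun n => γ m - γ (m + n)) atTop (𝓝 (γ m - 0)) := by
      refine tendsto_const_nhds.sub ?_
      simpa only [add_comm m] using (tendsto_add_atTop_iff_nat m).mpr hzero
    have := le_of_tendsto' hlim hn
    rw [sub_zero] at this
    exact le_of_mul_le_mul_left (by linarith) (hpos m)
  have h0 : Tendsto (fun m => μ * ∑' k, γ (k + m)) atTop (𝓝 (μ * 0)) :=
    (tendsto_sum_nat_add γ).const_mul μ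
  rw [mul_zero] at h0
  exact absurd (ge_of_tendsto' h0 htail) (by norm_num)

theorem relaxation_tendsto_zero (hpos : ∀ k, 0 < γ k) (hμ0 : 0 < μ)
    (hγ : ∀ k, γ (k + 1) = γ k * (1 - μ * γ k)) : Tendsto γ atTop (𝓝 0) := by
  have h := (relaxation_summable_sq hpos hμ0 hγ).tendsto_atTop_zero.sqrt
  simpa [Real.sqrt_sq (hpos _).le] using h

end Relaxation

/-- If `P` decreases by `α * y k` up to an error made of the `τ` last values of `z`, and `z k` is
eventually small compared with `y k`, then `y` is summable and `P` converges. -/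
theorem summable_and_tendsto_of_delayed_descent {P y z : ℕ → ℝ} {b α β : ℝ} {τ K : ℕ}
    (hP : ∀ k, b ≤ P k) (hα : 0 < α) (hβ : 0 ≤ β) (hy : ∀ k, 0 ≤ y k) (hz : ∀ k, 0 ≤ z k)
    (hzy : ∀ k, z k ≤ y k) (hsmall : ∀ k ≥ K, β * τ * z k ≤ α / 2 * y k)
    (hdec : ∀ k ≥ K, P (k + 1) ≤ P k - α * y k + β * ∑ t ∈ Finset.range τ, z (k - 1 - t)) :
    Summable y ∧ ∃ l, Tendsto P atTop (𝓝 l) := by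
  set Z : ℕ → ℝ := fun n => ∑ j ∈ Finset.range n, z j with hZ
  have hZmono : Monotone Z := fun a b hab =>
    Finset.sum_le_sum_of_subset_of_nonneg (Finset.range_mono hab) fun j _ _ => hz j
  -- The Lyapunov function: each `z j` is counted once for every iteration it may still disturb.
  set W : ℕ → ℝ := fun k => ∑ t ∈ Finset.range τ, (Z k - Z (k - 1 - t)) with hW
  have hW0 : ∀ k, 0 ≤ W k := fun k => Finset.sum_nonneg fun t _ =>
    sub_nonneg.mpr (hZmono (by omega))
  have hWstep : ∀ k ≥ τ, W (k + 1) = W k + τ * z k - ∑ t ∈ Finset.range τ, z (k - 1 - t) := by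
    intro k hk
    have h1 : (τ : ℝ) * z k = ∑ t ∈ Finset.range τ, z k := by simp
    rw [hW, h1, ← Finset.sum_add_distrib, ← Finset.sum_sub_distrib]
    refine Finset.sum_congr rfl fun t ht => ?_
    rw [Finset.mem_range] at ht
    have h2 : k + 1 - 1 - t = (k - 1 - t) + 1 := by omega
    simp only [hZ]
    rw [h2, Finset.sum_range_succ, Finset.sum_range_succ]
    ring
  set K' := max K τ with hK'
  set V : ℕ → ℝ := fun n => P (K' + n) + β * W (K' + n) with hV
  have hVb : ∀ n, b ≤ V n := fun n => by
    have := mul_nonneg hβ (hW0 (K' + n))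
    simp only [hV]
    linarith [hP (K' + n)]
  have hVstep : ∀ n, V (n + 1) ≤ V n - α / 2 * y (K' + n) := by
    intro n
    have h1 := hdec (K' + n) (by omega)
    have h2 := hsmall (K' + n) (by omega)
    simp only [hV]
    rw [← add_assoc, hWstep (K' + n) (by omega)]
    nlinarith
  have hVsum : ∀ n, α / 2 * ∑ k ∈ Finset.range n, y (k + K') ≤ V 0 - V n := by
    intro n
    induction n with
    | zero => simp
    | succ n ih =>
      rw [Finset.sum_range_succ, mul_add, add_comm n K']
      linarith [hVstep n]
  have hsum : Summable y := by
    rw [← summable_nat_add_iff K']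
    refine summable_of_sum_range_le (c := (V 0 - b) / (α / 2)) (fun k => hy _) fun n => ?_
    rw [le_div_iff₀ (by positivity)]
    linarith [hVsum n, hVb n]
  refine ⟨hsum, ?_⟩
  have hVanti : Antitone V := antitone_nat_of_succ_le fun n => by
    nlinarith [hVstep n, hy (K' + n)]
  have hVlim := tendsto_atTop_ciInf hVanti ⟨b, by rintro _ ⟨n, rfl⟩; exact hVb n⟩
  have hzsum : Summable z := Summable.of_nonneg_of_le hz hzy hsum
  have hZlim : Tendsto Z atTop (𝓝 (∑' j, z j)) := hzsum.hasSum.tendsto_sum_nat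
  have hWlim : Tendsto W atTop (𝓝 0) := by
    have : Tendsto W atTop (𝓝 (∑ _t ∈ Finset.range τ, (∑' j, z j - ∑' j, z j))) := by
      refine tendsto_finsetSum _ fun t _ => hZlim.sub (hZlim.comp ?_)
      exact (tendsto_sub_atTop_nat t).comp (tendsto_sub_atTop_nat 1)
    simpa using this
  refine ⟨⨅ n, V n, ?_⟩
  have hPV : Tendsto (fun n => P (n + K')) atTop (𝓝 (⨅ n, V n)) := by
    have hW' : Tendsto (fun n => β * W (n + K')) atTop (𝓝 (β * 0)) :=
      ((tendsto_add_atTop_iff_nat K').mpr hWlim).const_mul β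
    have := hVlim.sub hW'
    rw [mul_zero, sub_zero] at this
    refine this.congr fun n => ?_
    simp only [hV, add_comm K']
    ring
  exact (tendsto_add_atTop_iff_nat K').mp hPV

section Cluster

variable {γ p s : ℕ → ℝ} {T : ℕ} {pmin : ℝ}

/-- Weights that reach `pmin` at least once in every window of `T + 1` indices capture a fixed
proportion of the sums of an antitone sequence, up to the terms of one window. -/
theorem sum_le_of_window (hanti : Antitone γ) (hγ : ∀ k, 0 ≤ γ k) (hp : ∀ k, 0 ≤ p k)
    (hpmin : 0 < pmin) (hwin : ∀ k, ∃ t ≤ T, pmin ≤ p (k + t)) (n : ℕ) : ∀ m,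
    ∑ k ∈ Finset.range n, γ (m + k) ≤
      (T + 1) * γ m + (T + 1) / pmin * ∑ k ∈ Finset.range n, γ (m + k) * p (m + k) := by
  induction n using Nat.strong_induction_on with
  | _ n ih =>
  intro m
  have hnn : ∀ k, 0 ≤ γ k * p k := fun k => mul_nonneg (hγ k) (hp k)
  have hC : 0 ≤ (T + 1) / pmin := by positivity
  have hshort : ∀ n' ≤ T + 1, ∑ k ∈ Finset.range n', γ (m + k) ≤ (T + 1) * γ m := by
    intro n' hn'
    calc ∑ k ∈ Finset.range n', γ (m + k) ≤ ∑ k ∈ Finset.range n', γ m :=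
          Finset.sum_le_sum fun k _ => hanti (Nat.le_add_right m k)
      _ = n' * γ m := by simp
      _ ≤ (T + 1) * γ m := by
          have : (n' : ℝ) ≤ T + 1 := by exact_mod_cast hn'
          have := hγ m
          gcongr
  rcases Nat.le_total n (T + 1) with hn | hn
  · have : 0 ≤ ∑ k ∈ Finset.range n, γ (m + k) * p (m + k) :=
      Finset.sum_nonneg fun k _ => hnn _
    nlinarith [hshort n hn, mul_nonneg hC this]
  · obtain ⟨n', rfl⟩ := Nat.exists_eq_add_of_le hn
    rw [Finset.sum_range_add _ (T + 1) n', Finset.sum_range_add _ (T + 1) n', mul_add]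
    have h1 := hshort (T + 1) le_rfl
    have h2 := ih n' (by omega) (m + (T + 1))
    simp only [add_assoc m (T + 1)] at h2
    -- The first window of weights pays for the boundary term of the remaining sum.
    have h3 : (T + 1) * γ (m + (T + 1)) ≤
        (T + 1) / pmin * ∑ k ∈ Finset.range (T + 1), γ (m + k) * p (m + k) := by
      obtain ⟨t, ht, htp⟩ := hwin m
      have h4 : γ (m + t) * p (m + t) ≤ ∑ k ∈ Finset.range (T + 1), γ (m + k) * p (m + k) :=
        Finset.single_le_sum (f := fun k => γ (m + k) * p (m + k)) (fun k _ => hnn _)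
          (Finset.mem_range.mpr (by omega))
      have h5 : γ (m + (T + 1)) * pmin ≤ γ (m + t) * p (m + t) :=
        mul_le_mul (hanti (by omega)) htp hpmin.le (hγ _)
      calc (T + 1) * γ (m + (T + 1)) = (T + 1) / pmin * (γ (m + (T + 1)) * pmin) := by
            field_simp
        _ ≤ _ := mul_le_mul_of_nonneg_left (h5.trans h4) hC
    linarith

/-- Suppose that a sequence moves by at most `γ k + e k`, with `e` summable and `γ` not, that the
weights `s` follow, on average, weights `p` that reach `pmin` in every window, and that
`γ k * s k` is bounded by the terms of a convergent series as long as the sequence is close to `c`.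
Then `c` is not a cluster point: after a late visit near `c`, the sequence would spend so little
`γ`-time around `c` that it could not leave the neighbourhood, whereas `∑ γ k` is infinite. -/
theorem not_mapClusterPt_of_summable_near {X : Type*} [PseudoMetricSpace X] {v : ℕ → X} {c : X}
    {e e' : ℕ → ℝ} (hanti : Antitone γ) (hγ : ∀ k, 0 ≤ γ k) (hzero : Tendsto γ atTop (𝓝 0))
    (hdiv : ¬ Summable γ) (hp : ∀ k, 0 ≤ p k) (hpmin : 0 < pmin)
    (hwin : ∀ k, ∃ t ≤ T, pmin ≤ p (k + t))
    (hconv : ∃ l, Tendsto (fun n => ∑ k ∈ Finset.range n, γ k * (s k - p k)) atTop (𝓝 l))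
    (he : Summable e) (he0 : ∀ k, 0 ≤ e k) (he' : Summable e') (he0' : ∀ k, 0 ≤ e' k)
    (hmove : ∀ k, dist (v k) (v (k + 1)) ≤ γ k + e k)
    (hsel : ∃ ρ > 0, ∀ᶠ k in atTop, dist (v k) c < ρ → γ k * s k ≤ e' k) :
    ¬ MapClusterPt c atTop v := by
  intro hc
  obtain ⟨ρ, hρ, hsel⟩ := hsel
  obtain ⟨K, hK⟩ := eventually_atTop.mp hsel
  obtain ⟨l, hl⟩ := hconv
  set C : ℝ := (T + 1) / pmin with hCdef
  have hC : 0 < C := by positivity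
  set S : ℕ → ℝ := fun n => ∑ k ∈ Finset.range n, γ k * (s k - p k) with hS
  have hη : 0 < ρ / 4 / (C + 1) := by positivity
  obtain ⟨K₁, hK₁⟩ := Metric.cauchySeq_iff.mp hl.cauchySeq (ρ / 4 / (C + 1)) hη
  have hsmall : Tendsto (fun m => ((T + 1) * γ m + C * ∑' k, e' (k + m)) + ∑' k, e (k + m)) atTop
      (𝓝 (((T + 1) * 0 + C * 0) + 0)) :=
    ((hzero.const_mul _).add ((tendsto_sum_nat_add e').const_mul C)).add (tendsto_sum_nat_add e)
  have hev : ∀ᶠ m in atTop,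
      ((T + 1) * γ m + C * ∑' k, e' (k + m)) + ∑' k, e (k + m) < ρ / 4 :=
    hsmall.eventually_lt_const (by simpa using by positivity)
  obtain ⟨m, hmc, hm, hmK, hmK₁⟩ : ∃ m, dist (v m) c < ρ / 2 ∧
      (((T + 1) * γ m + C * ∑' k, e' (k + m)) + ∑' k, e (k + m) < ρ / 4) ∧ K ≤ m ∧ K₁ ≤ m := by
    have hfreq := hc.frequently (Metric.ball_mem_nhds c (half_pos hρ))
    obtain ⟨m, h1, h2, h3, h4⟩ := (hfreq.and_eventually (hev.and
      ((eventually_ge_atTop K).and (eventually_ge_atTop K₁)))).exists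
    exact ⟨m, h1, h2, h3, h4⟩
  have hEpos : 0 ≤ ∑' k, e (k + m) := tsum_nonneg fun k => he0 _
  -- The `γ`-time spent near `c` after the index `m` is small.
  have htime : ∀ n, (∀ k < n, dist (v (m + k)) c < ρ) →
      ∑ k ∈ Finset.range n, γ (m + k) + ∑' k, e (k + m) < ρ / 2 := by
    intro n hn
    have h1 := sum_le_of_window hanti hγ hp hpmin hwin n m
    have h2 : ∑ k ∈ Finset.range n, γ (m + k) * s (m + k) ≤ ∑' k, e' (k + m) := by
      calc ∑ k ∈ Finset.range n, γ (m + k) * s (m + k) ≤ ∑ k ∈ Finset.range n, e' (k + m) := by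
            refine Finset.sum_le_sum fun k hk => ?_
            rw [add_comm k m]
            exact hK (m + k) (by omega) (hn k (Finset.mem_range.mp hk))
        _ ≤ _ := ((summable_nat_add_iff m).mpr he').sum_le_tsum _ fun k _ => he0' _
    have h3 : S (m + n) - S m = ∑ k ∈ Finset.range n, γ (m + k) * s (m + k)
        - ∑ k ∈ Finset.range n, γ (m + k) * p (m + k) := by
      simp only [hS]
      rw [Finset.sum_range_add, add_sub_cancel_left, ← Finset.sum_sub_distrib]
      exact Finset.sum_congr rfl fun k _ => by ring
    have h4 : |S (m + n) - S m| < ρ / 4 / (C + 1) := by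
      rw [← Real.dist_eq]; exact hK₁ _ (by omega) _ hmK₁
    have h5 : ∑ k ∈ Finset.range n, γ (m + k) * p (m + k) ≤
        ∑' k, e' (k + m) + ρ / 4 / (C + 1) := by
      have := (abs_lt.mp h4).1
      linarith
    have h6 : C * (ρ / 4 / (C + 1)) ≤ ρ / 4 := by
      rw [mul_div_assoc', div_le_iff₀ (by positivity)]
      nlinarith
    have h7 := mul_le_mul_of_nonneg_left h5 hC.le
    rw [← hCdef] at h1
    linarith
  have hstay : ∀ n, dist (v (m + n)) c < ρ := by
    intro n
    induction n using Nat.strong_induction_on with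
    | _ n ih =>
    have h1 : dist (v (m + 0)) (v (m + n)) ≤ ∑ k ∈ Finset.range n, (γ (m + k) + e (k + m)) := by
      refine (dist_le_range_sum_dist (fun k => v (m + k)) n).trans ?_
      refine Finset.sum_le_sum fun k _ => ?_
      rw [add_comm k m]
      exact hmove (m + k)
    rw [Finset.sum_add_distrib, add_zero] at h1
    have h2 : ∑ k ∈ Finset.range n, e (k + m) ≤ ∑' k, e (k + m) :=
      ((summable_nat_add_iff m).mpr he).sum_le_tsum _ fun k _ => he0 _
    have h3 := htime n ih
    have h4 := dist_triangle_left (v (m + n)) c (v m)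
    linarith
  refine hdiv ((summable_nat_add_iff m).mp ?_)
  refine summable_of_sum_range_le (c := ρ / 2) (fun k => hγ _) fun n => ?_
  simp only [add_comm _ m]
  have := htime n fun k _ => hstay k
  simp only [add_comm _ m] at this hEpos
  linarith

end Cluster

/-! ### Selection frequencies -/

section Selection

variable {Ω : Type*} [m0 : MeasurableSpace Ω] {P : Measure Ω} [IsProbabilityMeasure P]

/-- Conditioning on a discrete random variable `H`: the conditional expectation is given by the
elementary conditional probabilities given the values of `H`. -/
theorem cond_real_ae_eq_condExp_comap {β : Type*} [Countable β] [MeasurableSpace β]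
    [MeasurableSingletonClass β] {H : Ω → β} (hH : Measurable H) {s : Set Ω}
    (hs : MeasurableSet s) :
    (fun x => (P[|H ⁻¹' {H x}]).real s) =ᵐ[P]
      P[s.indicator (fun _ => (1 : ℝ)) | MeasurableSpace.comap H inferInstance] := by
  have hmeas : Measurable[MeasurableSpace.comap H inferInstance]
      fun x => (P[|H ⁻¹' {H x}]).real s :=
    (measurable_of_countable fun b => (P[|H ⁻¹' {b}]).real s).comp (comap_measurable H)
  have hle : ∀ x, (P[|H ⁻¹' {H x}]).real s ≤ 1 := fun x => by
    rcases eq_or_ne (P (H ⁻¹' {H x})) 0 with h | h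
    · simp [measureReal_def, ProbabilityTheory.cond, Measure.restrict_eq_zero.mpr h]
    · have := cond_isProbabilityMeasure h
      exact measureReal_le_one
  have hint : Integrable (fun x => (P[|H ⁻¹' {H x}]).real s) P := by
    refine Integrable.of_bound (hmeas.mono hH.comap_le le_rfl).aestronglyMeasurable 1
      (Eventually.of_forall fun x => ?_)
    rw [Real.norm_eq_abs, abs_of_nonneg measureReal_nonneg]
    exact hle x
  have hint1 : Integrable (s.indicator fun _ => (1 : ℝ)) P := (integrable_const 1).indicator hs
  refine ae_eq_condExp_of_forall_setIntegral_eq hH.comap_le hint1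
    (fun _ _ _ => hint.integrableOn) ?_ hmeas.aestronglyMeasurable
  rintro _ ⟨B, hB, rfl⟩ -
  -- Split the event `H ∈ B` according to the value of `H`.
  have hU : H ⁻¹' B = ⋃ b : B, H ⁻¹' {(b : β)} := by
    ext x; simp
  have hm : ∀ b : B, MeasurableSet (H ⁻¹' {(b : β)}) := fun b => hH (measurableSet_singleton _)
  have hd : Pairwise (Function.onFun Disjoint fun b : B => H ⁻¹' {(b : β)}) := fun a b hab =>
    Disjoint.preimage _ (Set.disjoint_singleton.mpr fun h => hab (Subtype.ext h))
  rw [hU, integral_iUnion hm hd hint.integrableOn, integral_iUnion hm hd hint1.integrableOn]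
  refine tsum_congr fun b => ?_
  rw [setIntegral_congr_fun (hm b) (g := fun _ => (P[|H ⁻¹' {(b : β)}]).real s)
    (fun x hx => by rw [Set.mem_preimage, Set.mem_singleton_iff] at hx; simp only [hx]),
    setIntegral_const, setIntegral_indicator hs, setIntegral_const, smul_eq_mul, smul_eq_mul,
    mul_one, measureReal_def, measureReal_def, measureReal_def, ← ENNReal.toReal_mul, mul_comm,
    cond_mul_eq_inter (hm b), Set.inter_comm]

/-- A series of bounded martingale differences converges almost surely if the squares of the bounds
are summable. -/
theorem ae_tendsto_sum_of_condExp_eq_zero {ℱ : Filtration ℕ m0} {D : ℕ → Ω → ℝ} {γ : ℕ → ℝ}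
    (hD : ∀ k, StronglyMeasurable[ℱ (k + 1)] (D k)) (hb : ∀ k x, |D k x| ≤ γ k)
    (h0 : ∀ k, P[D k | ℱ k] =ᵐ[P] 0) (hγ : Summable fun k => γ k ^ 2) :
    ∀ᵐ x ∂P, ∃ l, Tendsto (fun n => ∑ k ∈ Finset.range n, D k x) atTop (𝓝 l) := by
  set S : ℕ → Ω → ℝ := fun n x => ∑ k ∈ Finset.range n, D k x with hS
  have hSm : ∀ n, StronglyMeasurable[ℱ n] (S n) := fun n =>
    Finset.stronglyMeasurable_fun_sum _ fun k hk =>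
      (hD k).mono (ℱ.mono (Finset.mem_range.mp hk))
  have hSb : ∀ n x, ‖S n x‖ ≤ ∑ k ∈ Finset.range n, γ k := fun n x =>
    (norm_sum_le _ _).trans (Finset.sum_le_sum fun k _ => hb k x)
  have hDm : ∀ k, AEStronglyMeasurable (D k) P := fun k =>
    ((hD k).mono (ℱ.le _)).aestronglyMeasurable
  have hSm' : ∀ n, AEStronglyMeasurable (S n) P := fun n =>
    ((hSm n).mono (ℱ.le _)).aestronglyMeasurable
  have hDint : ∀ k, Integrable (D k) P := fun k =>
    Integrable.of_bound (hDm k) (γ k) (Eventually.of_forall (hb k))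
  have hSint : ∀ n, Integrable (S n) P := fun n =>
    Integrable.of_bound (hSm' n) _ (Eventually.of_forall (hSb n))
  have hSDint : ∀ n, Integrable (S n * D n) P := fun n =>
    (hDint n).bdd_mul (hSm' n) (Eventually.of_forall (hSb n))
  have hS2int : ∀ n, Integrable (fun x => S n x ^ 2) P := fun n => by
    simpa only [sq] using (hSint n).bdd_mul (hSm' n) (Eventually.of_forall (hSb n))
  have hD2int : ∀ n, Integrable (fun x => D n x ^ 2) P := fun n => by
    simpa only [sq] using (hDint n).bdd_mul (hDm n) (Eventually.of_forall (hb n))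
  have hmart : Martingale S ℱ P := by
    refine martingale_of_condExp_sub_eq_zero_nat hSm hSint fun n => ?_
    have : S (n + 1) - S n = D n := by
      ext x; simp [hS, Finset.sum_range_succ]
    rw [this]
    exact h0 n
  have horth : ∀ n, ∫ x, S n x * D n x ∂P = 0 := by
    intro n
    have h1 : P[S n * D n | ℱ n] =ᵐ[P] 0 := by
      filter_upwards [condExp_mul_of_stronglyMeasurable_left (hSm n) (hSDint n) (hDint n), h0 n]
        with x hx hx0
      rw [hx, Pi.mul_apply, hx0]
      simp
    have h2 := integral_condExp (μ := P) (f := S n * D n) (ℱ.le n)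
    rw [integral_congr_ae h1] at h2
    simpa using h2.symm
  have hvar : ∀ n, ∫ x, S n x ^ 2 ∂P ≤ ∑ k ∈ Finset.range n, γ k ^ 2 := by
    intro n
    induction n with
    | zero => simp [hS]
    | succ n ih =>
      have h1 : ∀ x, S (n + 1) x ^ 2 = S n x ^ 2 + 2 * (S n x * D n x) + D n x ^ 2 := fun x => by
        simp only [hS, Finset.sum_range_succ]; ring
      have h2 : ∫ x, D n x ^ 2 ∂P ≤ γ n ^ 2 := by
        have h3 : ∫ x, D n x ^ 2 ∂P ≤ ∫ _, γ n ^ 2 ∂P :=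
          integral_mono (hD2int n) (integrable_const _) fun x => sq_le_sq' (abs_le.mp (hb n x)).1
            (abs_le.mp (hb n x)).2
        simpa using h3
      simp only [h1]
      have hSD : Integrable (fun x => 2 * (S n x * D n x)) P := (hSDint n).const_mul 2
      rw [integral_add (f := fun x => S n x ^ 2 + 2 * (S n x * D n x)) ((hS2int n).add hSD)
        (hD2int n), integral_add (hS2int n) hSD,
        integral_const_mul, horth, Finset.sum_range_succ]
      linarith
  have hL1 : ∀ n, eLpNorm (S n) 1 P ≤ (1 + ∑' k, γ k ^ 2).toNNReal := by
    intro n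
    rw [eLpNorm_one_eq_lintegral_enorm, ← ofReal_integral_norm_eq_lintegral_enorm (hSint n)]
    change ENNReal.ofReal _ ≤ ENNReal.ofReal _
    refine ENNReal.ofReal_le_ofReal ?_
    have h1 : ∫ x, ‖S n x‖ ∂P ≤ ∫ x, (1 + S n x ^ 2) ∂P := by
      refine integral_mono (hSint n).norm ((integrable_const 1).add (hS2int n)) fun x => ?_
      have := sq_abs (S n x)
      simp only [Real.norm_eq_abs]
      nlinarith [sq_nonneg (|S n x| - 1), abs_nonneg (S n x)]
    rw [integral_add (integrable_const 1) (hS2int n)] at h1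
    have h2 := hγ.sum_le_tsum (Finset.range n) fun k _ => sq_nonneg _
    simp only [integral_const, probReal_univ, one_smul] at h1
    linarith [hvar n]
  exact hmart.submartingale.exists_ae_tendsto_of_bdd hL1

variable {N : ℕ}

/-- The filtration generated by the worker/delay pairs; at time `k` it contains the pairs of the
iterations `0, …, k - 1`. -/
def pastFiltration {w : ℕ → Ω → Fin N} {d : ℕ → Ω → ℕ} (hw : ∀ k, Measurable (w k))
    (hd : ∀ k, Measurable (d k)) : Filtration ℕ m0 where
  seq k := MeasurableSpace.comap (fun x (j : Fin k) => (w j x, d j x)) inferInstance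
  mono' k l hkl := by
    have h : (fun x (j : Fin k) => (w j x, d j x))
        = (fun (a : Fin l → Fin N × ℕ) (j : Fin k) => a (Fin.castLE hkl j)) ∘
          fun x (j : Fin l) => (w j x, d j x) := rfl
    simp only [h]
    rw [← MeasurableSpace.comap_comp]
    exact MeasurableSpace.comap_mono (Measurable.comap_le (by fun_prop))
  le' k := Measurable.comap_le (measurable_pi_lambda _ fun j => (hw j).prodMk (hd j))

/-- Along the iterations, the selections of a worker, weighted by `γ`, follow their conditional
probabilities up to a convergent series. -/
theorem DelayModel.ae_tendsto_sum {w : ℕ → Ω → Fin N} {d : ℕ → Ω → ℕ} (hm : DelayModel P w d)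
    {γ : ℕ → ℝ} (hγ0 : ∀ k, 0 ≤ γ k) (hγ : Summable fun k => γ k ^ 2) (i : Fin N) :
    ∀ᵐ x ∂P, ∃ l, Tendsto (fun n => ∑ k ∈ Finset.range n,
      γ k * ((if w k x = i then 1 else 0) - (P[|history w d k x]).real {y | w k y = i}))
      atTop (𝓝 l) := by
  set ℱ := pastFiltration hm.measurable_worker hm.measurable_delay with hℱ
  have hs : ∀ k, MeasurableSet {y | w k y = i} := fun k =>
    hm.measurable_worker k (measurableSet_singleton i)
  have hH : ∀ k, Measurable fun x (j : Fin k) => (w j x, d j x) := fun k =>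
    measurable_pi_lambda _ fun j => (hm.measurable_worker j).prodMk (hm.measurable_delay j)
  have hhist : ∀ k x, history w d k x =
      (fun x (j : Fin k) => (w j x, d j x)) ⁻¹' {fun j : Fin k => (w j x, d j x)} := by
    intro k x
    ext y
    simp only [history, Set.mem_ofPred_eq, Set.mem_preimage, Set.mem_singleton_iff, funext_iff,
      Prod.mk.injEq, Fin.forall_iff]
  set p : ℕ → Ω → ℝ := fun k x => (P[|history w d k x]).real {y | w k y = i} with hp
  set q : ℕ → Ω → ℝ := fun k => {y | w k y = i}.indicator fun _ => 1 with hq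
  have hpq : ∀ k, p k =ᵐ[P] P[q k | ℱ k] := fun k => by
    have := cond_real_ae_eq_condExp_comap (P := P) (hH k) (hs k)
    simp only [hp, hhist]
    exact this
  have hpm : ∀ k, Measurable[ℱ k] (p k) := fun k => by
    simp only [hp, hhist]
    exact (measurable_of_countable fun b : Fin k → Fin N × ℕ =>
      (P[|(fun x (j : Fin k) => (w j x, d j x)) ⁻¹' {b}]).real {y | w k y = i}).comp
      (comap_measurable _)
  have hqm : ∀ k, Measurable[ℱ (k + 1)] (q k) := fun k => by
    refine Measurable.indicator (measurable_const) ?_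
    refine ⟨{a | (a (Fin.last k)).1 = i}, ?_, ?_⟩
    · exact (measurable_fst.comp (measurable_pi_apply (Fin.last k))) (measurableSet_singleton i)
    · ext x; simp
  have hp1 : ∀ k x, p k x ≤ 1 := fun k x => by
    rcases eq_or_ne (P (history w d k x)) 0 with h | h
    · simp [hp, measureReal_def, ProbabilityTheory.cond, Measure.restrict_eq_zero.mpr h]
    · have := cond_isProbabilityMeasure h
      exact measureReal_le_one
  have hp0 : ∀ k x, 0 ≤ p k x := fun k x => measureReal_nonneg
  have hqint : ∀ k, Integrable (q k) P := fun k => (integrable_const 1).indicator (hs k)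
  have hpint : ∀ k, Integrable (p k) P := fun k => integrable_condExp.congr (hpq k).symm
  have hconv := ae_tendsto_sum_of_condExp_eq_zero (P := P) (ℱ := ℱ) (γ := γ)
    (D := fun k => γ k • (q k - p k)) ?_ ?_ ?_ hγ
  · filter_upwards [hconv] with x hx
    simpa [hq, hp, Set.indicator_apply] using hx
  · intro k
    exact ((hqm k).stronglyMeasurable.sub
      ((hpm k).mono (ℱ.mono (Nat.le_succ k)) le_rfl).stronglyMeasurable).const_smul (γ k)
  · intro k x
    have h0 : |q k x - p k x| ≤ 1 := by
      have h1 := hp0 k x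
      have h2 := hp1 k x
      by_cases h : w k x = i
      · have : q k x = 1 := by simp [hq, h]
        rw [this, abs_le]; constructor <;> linarith
      · have : q k x = 0 := by simp [hq, h]
        rw [this, abs_le]; constructor <;> linarith
    rw [Pi.smul_apply, Pi.sub_apply, smul_eq_mul, abs_mul, abs_of_nonneg (hγ0 k)]
    exact mul_le_of_le_one_right (hγ0 k) h0
  · intro k
    have h1 : P[p k | ℱ k] = p k :=
      condExp_of_stronglyMeasurable (ℱ.le k) (hpm k).stronglyMeasurable (hpint k)
    filter_upwards [condExp_smul (μ := P) (γ k) (q k - p k) (ℱ k),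
      condExp_sub (hqint k) (hpint k) (ℱ k), hpq k] with x hx1 hx2 hx3
    rw [hx1, Pi.smul_apply, hx2, Pi.sub_apply, h1, ← hx3]
    simp

end Selection

/-! ### The objective: partial gradients and critical points -/

section PartialGradient

variable {E E' : Type*} [NormedAddCommGroup E] [InnerProductSpace ℝ E]
  [NormedAddCommGroup E'] [InnerProductSpace ℝ E'] {φ : E → E' → ℝ}

theorem hasFDerivAt_left (hφ : ContDiff ℝ 1 fun p : E × E' => φ p.1 p.2) (X : E) (M : E') :
    HasFDerivAt (fun X => φ X M)
      ((fderiv ℝ (fun p : E × E' => φ p.1 p.2) (X, M)).comp (ContinuousLinearMap.inl ℝ E E')) X :=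
  ((hφ.differentiable one_ne_zero (X, M)).hasFDerivAt).comp (f := fun X => (X, M)) X
    (hasFDerivAt_prodMk_left X M)

theorem hasFDerivAt_right (hφ : ContDiff ℝ 1 fun p : E × E' => φ p.1 p.2) (X : E) (M : E') :
    HasFDerivAt (fun M => φ X M)
      ((fderiv ℝ (fun p : E × E' => φ p.1 p.2) (X, M)).comp (ContinuousLinearMap.inr ℝ E E')) M :=
  ((hφ.differentiable one_ne_zero (X, M)).hasFDerivAt).comp (f := fun M => (X, M)) M
    (hasFDerivAt_prodMk_right X M)

theorem continuous_gradient_left [CompleteSpace E] (hφ : ContDiff ℝ 1 fun p : E × E' => φ p.1 p.2) :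
    Continuous fun p : E × E' => gradient (fun X => φ X p.2) p.1 := by
  have h : (fun p : E × E' => gradient (fun X => φ X p.2) p.1) = fun p =>
      (InnerProductSpace.toDual ℝ E).symm
        ((fderiv ℝ (fun p : E × E' => φ p.1 p.2) p).comp (ContinuousLinearMap.inl ℝ E E')) := by
    ext1 p
    rw [gradient, (hasFDerivAt_left hφ p.1 p.2).fderiv]
  rw [h]
  exact (LinearIsometryEquiv.continuous _).comp
    ((hφ.continuous_fderiv one_ne_zero).clm_comp continuous_const)

theorem continuous_gradient_right [CompleteSpace E'] (hφ : ContDiff ℝ 1 fun p : E × E' => φ p.1 p.2) :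
    Continuous fun p : E × E' => gradient (fun M => φ p.1 M) p.2 := by
  have h : (fun p : E × E' => gradient (fun M => φ p.1 M) p.2) = fun p =>
      (InnerProductSpace.toDual ℝ E').symm
        ((fderiv ℝ (fun p : E × E' => φ p.1 p.2) p).comp (ContinuousLinearMap.inr ℝ E E')) := by
    ext1 p
    rw [gradient, (hasFDerivAt_right hφ p.1 p.2).fderiv]
  rw [h]
  exact (LinearIsometryEquiv.continuous _).comp
    ((hφ.continuous_fderiv one_ne_zero).clm_comp continuous_const)

theorem fderiv_apply_eq_inner_add_inner [CompleteSpace E] [CompleteSpace E']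
    (hφ : ContDiff ℝ 1 fun p : E × E' => φ p.1 p.2)
    (X : E) (M : E') (h : E × E') :
    fderiv ℝ (fun p : E × E' => φ p.1 p.2) (X, M) h =
      inner ℝ (gradient (fun X => φ X M) X) h.1 + inner ℝ (gradient (fun M => φ X M) M) h.2 := by
  rw [gradient, gradient, (hasFDerivAt_left hφ X M).fderiv, (hasFDerivAt_right hφ X M).fderiv,
    InnerProductSpace.toDual_symm_apply, InnerProductSpace.toDual_symm_apply]
  simp [← map_add]

end PartialGradient

theorem coe_finsetSum {ι : Type*} (s : Finset ι) (a : ι → ℝ) :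
    ((∑ i ∈ s, a i : ℝ) : EReal) = ∑ i ∈ s, (a i : EReal) := by
  classical
  induction s using Finset.induction_on with
  | empty => simp
  | insert i s hi ih => rw [Finset.sum_insert hi, Finset.sum_insert hi, EReal.coe_add, ih]

section Problem

variable {N L R : ℕ} {n : Fin N → ℕ} {f : ∀ i, RMat R (n i) → RMat L R → ℝ}
  {g : ∀ i, RMat R (n i) → EReal} {r : RMat L R → EReal} {LA : Fin N → RMat L R → ℝ≥0}
  {LM : Locals R n → ℝ≥0}

/-- The objective at a point where it is finite, as a real number. -/
noncomputable def realObjective (f : ∀ i, RMat R (n i) → RMat L R → ℝ)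
    (g : ∀ i, RMat R (n i) → EReal) (r : RMat L R → EReal) (A : Locals R n) (M : RMat L R) : ℝ :=
  coupling f A M + ∑ i, (g i (A i)).toReal + (r M).toReal

theorem PALMAssumptions.objective_eq_coe (h : PALMAssumptions f g r LA LM) {A : Locals R n}
    {M : RMat L R} (hA : ∀ i, g i (A i) ≠ ⊤) (hM : r M ≠ ⊤) :
    objective f g r (WithLp.toLp 2 (A, M)) = (realObjective f g r A M : EReal) := by
  rw [objective, realObjective, EReal.coe_add, EReal.coe_add, coe_finsetSum,
    EReal.coe_toReal hM (h.r_convex.ne_bot _)]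
  congr 2
  exact Finset.sum_congr rfl fun i _ => (EReal.coe_toReal (hA i) ((h.g_convex i).ne_bot _)).symm

theorem PALMAssumptions.differentiableAt_coupling (h : PALMAssumptions f g r LA LM)
    (A : Locals R n) (M : RMat L R) : DifferentiableAt ℝ (fun M => coupling f A M) M :=
  DifferentiableAt.fun_sum fun i _ =>
    (hasFDerivAt_right (h.f_contDiff i) (A i) M).differentiableAt

theorem PALMAssumptions.convexOn_coupling (h : PALMAssumptions f g r LA LM) (A : Locals R n) :
    ConvexOn ℝ Set.univ fun M => coupling f A M := by
  refine ⟨convex_univ, fun x _ y _ a b ha hb hab => ?_⟩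
  simp only [coupling, smul_eq_mul, Finset.mul_sum, ← Finset.sum_add_distrib]
  exact Finset.sum_le_sum fun i _ =>
    (h.f_convex_right i (A i)).2 (Set.mem_univ x) (Set.mem_univ y) ha hb hab

theorem PALMAssumptions.gradient_coupling (h : PALMAssumptions f g r LA LM)
    (A : Locals R n) (M : RMat L R) :
    gradient (fun M => coupling f A M) M = ∑ i, gradient (fun M => f i (A i) M) M := by
  simp only [gradient, ← map_sum]
  congr 1
  exact fderiv_fun_sum fun i _ => (hasFDerivAt_right (h.f_contDiff i) (A i) M).differentiableAt

theorem PALMAssumptions.continuous_gradient_coupling (h : PALMAssumptions f g r LA LM) :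
    Continuous fun p : Locals R n × RMat L R => gradient (fun M => coupling f p.1 M) p.2 := by
  simp only [h.gradient_coupling]
  refine continuous_finsetSum _ fun i _ => ?_
  exact (continuous_gradient_right (h.f_contDiff i)).comp
    (f := fun p : Locals R n × RMat L R => (p.1 i, p.2)) (by fun_prop)

theorem PALMAssumptions.hasFDerivAt_coupling (h : PALMAssumptions f g r LA LM)
    (v : Joint L R n) : ∃ D : Joint L R n →L[ℝ] ℝ,
      HasFDerivAt (fun v : Joint L R n => coupling f v.fst v.snd) D v ∧
      ∀ u, D u = ∑ i, inner ℝ (gradient (fun X => f i X v.snd) (v.fst i)) (u.fst i) +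
        inner ℝ (gradient (fun M => coupling f v.fst M) v.snd) u.snd := by
  set P : ∀ i, Joint L R n →L[ℝ] RMat R (n i) × RMat L R := fun i =>
    ((PiLp.proj 2 (fun i => RMat R (n i)) i).comp (WithLp.fstL 2 ℝ _ _)).prod
      (WithLp.sndL 2 ℝ _ _) with hP
  refine ⟨∑ i, (fderiv ℝ (fun p : RMat R (n i) × RMat L R => f i p.1 p.2)
    (v.fst i, v.snd)).comp (P i), ?_, fun u => ?_⟩
  · refine HasFDerivAt.fun_sum fun i _ => ?_
    exact HasFDerivAt.comp (g := fun p : RMat R (n i) × RMat L R => f i p.1 p.2) (f := P i) v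
      (((h.f_contDiff i).differentiable one_ne_zero (v.fst i, v.snd)).hasFDerivAt)
      (P i).hasFDerivAt
  · rw [h.gradient_coupling, sum_inner, ← Finset.sum_add_distrib, sum_apply]
    refine Finset.sum_congr rfl fun i _ => ?_
    exact fderiv_apply_eq_inner_add_inner (h.f_contDiff i) (v.fst i) v.snd (P i u)

/-- A point where the negative partial gradients of the smooth part are convex subgradients of the
`g i` and of `r` is critical: zero is even a Fréchet subgradient there. -/
theorem PALMAssumptions.isCriticalPoint (h : PALMAssumptions f g r LA LM) {v : Joint L R n}
    (hA : ∀ i u, g i (v.fst i) +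
      ((inner ℝ (-gradient (fun X => f i X v.snd) (v.fst i)) (u - v.fst i) : ℝ) : EReal) ≤ g i u)
    (hM : ∀ u, r v.snd +
      ((inner ℝ (-gradient (fun M => coupling f v.fst M) v.snd) (u - v.snd) : ℝ) : EReal) ≤ r u) :
    IsCriticalPoint (objective f g r) v := by
  have hAt : ∀ i, g i (v.fst i) ≠ ⊤ := by
    intro i hi
    obtain ⟨u, hu⟩ := (h.g_convex i).proper
    have := hA i u
    rw [hi, EReal.top_add_coe] at this
    exact hu (top_le_iff.mp this)
  have hMt : r v.snd ≠ ⊤ := by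
    intro hi
    obtain ⟨u, hu⟩ := h.r_convex.proper
    have := hM u
    rw [hi, EReal.top_add_coe] at this
    exact hu (top_le_iff.mp this)
  have hval : objective f g r v = (realObjective f g r v.fst v.snd : EReal) :=
    h.objective_eq_coe hAt hMt
  have hbot : objective f g r v ≠ ⊥ := by rw [hval]; exact EReal.coe_ne_bot _
  have htop : objective f g r v ≠ ⊤ := by rw [hval]; exact EReal.coe_ne_top _
  have hfrechet : IsFrechetSubgradient (objective f g r) v 0 := by
    refine ⟨hbot, htop, fun ε hε => ?_⟩
    obtain ⟨D, hD, hDu⟩ := h.hasFDerivAt_coupling v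
    filter_upwards [hD.isLittleO.def hε] with y hy
    rw [hDu, Real.norm_eq_abs] at hy
    have hy' := (abs_le.mp hy).1
    rw [hval, objective, ← EReal.coe_add, inner_zero_left, zero_sub]
    have hg : ((∑ i, ((g i (v.fst i)).toReal +
        inner ℝ (-gradient (fun X => f i X v.snd) (v.fst i)) (y.fst i - v.fst i)) : ℝ) : EReal) ≤
          ∑ i, g i (y.fst i) := by
      rw [coe_finsetSum]
      refine Finset.sum_le_sum fun i _ => ?_
      rw [EReal.coe_add, EReal.coe_toReal (hAt i) ((h.g_convex i).ne_bot _)]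
      exact hA i (y.fst i)
    have hr := hM y.snd
    rw [← EReal.coe_toReal hMt (h.r_convex.ne_bot _), ← EReal.coe_add] at hr
    refine le_trans ?_ (add_le_add (add_le_add le_rfl hg) hr)
    rw [← EReal.coe_add, ← EReal.coe_add, EReal.coe_le_coe_iff, realObjective,
      Finset.sum_add_distrib]
    simp only [inner_neg_left, Finset.sum_neg_distrib]
    simp only [WithLp.sub_fst, WithLp.sub_snd, PiLp.sub_apply] at hy'
    linarith
  exact ⟨hbot, htop, fun _ => v, fun _ => 0, tendsto_const_nhds, tendsto_const_nhds,
    fun _ => hfrechet, tendsto_const_nhds⟩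

end Problem

/-! ### Trajectories of the algorithm -/

section Trajectory

variable {N L R : ℕ} {n : Fin N → ℕ} {f : ∀ i, RMat R (n i) → RMat L R → ℝ}
  {g : ∀ i, RMat R (n i) → EReal} {r : RMat L R → EReal} {LA : Fin N → RMat L R → ℝ≥0}
  {LM : Locals R n → ℝ≥0} {LAM : ∀ i, RMat R (n i) → ℝ≥0} {γ : ℕ → ℝ}
  {w : ℕ → Fin N} {d : ℕ → ℕ} {A : ℕ → Locals R n} {M : ℕ → RMat L R}
  {Ahat : ∀ k, RMat R (n (w k))} {Mhat : ℕ → RMat L R} {lo hi : ℝ} {τ : ℕ}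

/-- A single trajectory of the algorithm, with explicit values `Ahat k`, `Mhat k` of the proximal
maps, feasible initial point, step-size parameters in `[lo, hi]` with `0 < lo`, delays at most `τ`,
and every worker selected infinitely often. -/
structure IsTrajectory (f : ∀ i, RMat R (n i) → RMat L R → ℝ) (g : ∀ i, RMat R (n i) → EReal)
    (r : RMat L R → EReal) (LA : Fin N → RMat L R → ℝ≥0) (LM : Locals R n → ℝ≥0)
    (LAM : ∀ i, RMat R (n i) → ℝ≥0) (γ : ℕ → ℝ) (w : ℕ → Fin N) (d : ℕ → ℕ)
    (A : ℕ → Locals R n) (M : ℕ → RMat L R) (Ahat : ∀ k, RMat R (n (w k)))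
    (Mhat : ℕ → RMat L R) (lo hi : ℝ) (τ : ℕ) : Prop where
  init_local : ∀ i, g i (A 0 i) ≠ ⊤
  init_shared : r (M 0) ≠ ⊤
  prox_worker : ∀ k, IsProx (LA (w k) (M (k - d k)) : ℝ) (g (w k))
    (A k (w k) - (LA (w k) (M (k - d k)) : ℝ)⁻¹ •
      gradient (fun X => f (w k) X (M (k - d k))) (A k (w k))) (Ahat k)
  update_worker : ∀ k, A (k + 1) (w k) = A k (w k) + γ k • (Ahat k - A k (w k))
  idle : ∀ k i, i ≠ w k → A (k + 1) i = A k i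
  prox_master : ∀ k, IsProx (LM (A (k + 1)) : ℝ) r
    (M k - (LM (A (k + 1)) : ℝ)⁻¹ • gradient (fun X => coupling f (A (k + 1)) X) (M k)) (Mhat k)
  update_master : ∀ k, M (k + 1) = M k + γ k • (Mhat k - M k)
  lo_pos : 0 < lo
  le_LA : ∀ k, lo ≤ LA (w k) (M (k - d k))
  LA_le : ∀ k, LA (w k) (M (k - d k)) ≤ hi
  le_LM : ∀ k, lo ≤ LM (A (k + 1))
  LM_le : ∀ k, LM (A (k + 1)) ≤ hi
  LAM_le : ∀ k, LAM (w k) (A k (w k)) ≤ hi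
  delay_le : ∀ k, d k ≤ τ
  recurrent : ∀ i k, ∃ k' ≥ k, w k' = i

/-- The sum of the squared lengths of the two proximal steps at iteration `k`, weighted by `γ k`. -/
noncomputable def stepEnergy (γ : ℕ → ℝ) (w : ℕ → Fin N) (A : ℕ → Locals R n)
    (M : ℕ → RMat L R) (Ahat : ∀ k, RMat R (n (w k))) (Mhat : ℕ → RMat L R) (k : ℕ) : ℝ :=
  γ k * (‖Ahat k - A k (w k)‖ ^ 2 + ‖Mhat k - M k‖ ^ 2)

theorem dist_sub_le_sum {X : Type*} [PseudoMetricSpace X] (u : ℕ → X) {k : ℕ} :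
    ∀ {d : ℕ}, d ≤ k → dist (u k) (u (k - d)) ≤
      ∑ t ∈ Finset.range d, dist (u (k - 1 - t)) (u (k - 1 - t + 1)) := by
  intro d
  induction d with
  | zero => intro _; simp
  | succ d ih =>
    intro hd
    rw [Finset.sum_range_succ]
    refine (dist_triangle _ (u (k - d)) _).trans (add_le_add (ih (by omega)) ?_)
    have h1 : k - 1 - d + 1 = k - d := by omega
    have h2 : k - 1 - d = k - (d + 1) := by omega
    rw [h1, h2, dist_comm]

theorem sum_sub_sum_eq_single {ι : Type*} [Fintype ι] {a b : ι → ℝ} (j : ι)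
    (h : ∀ i, i ≠ j → a i = b i) : ∑ i, a i - ∑ i, b i = a j - b j := by
  rw [← Finset.sum_sub_distrib]
  exact Finset.sum_eq_single j (fun i _ hi => sub_eq_zero.mpr (h i hi))
    fun hj => absurd (Finset.mem_univ j) hj

namespace IsTrajectory

theorem hi_pos (ht : IsTrajectory f g r LA LM LAM γ w d A M Ahat Mhat lo hi τ) : 0 < hi :=
  ht.lo_pos.trans_le ((ht.le_LM 0).trans (ht.LM_le 0))

/-- The value of `LAM` at the updated local variable is bounded too, because this variable stays
unchanged until its worker is selected again. -/
theorem LAM_next_le (ht : IsTrajectory f g r LA LM LAM γ w d A M Ahat Mhat lo hi τ) (k : ℕ) :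
    LAM (w k) (A (k + 1) (w k)) ≤ hi := by
  classical
  have hex : ∃ j, w (k + 1 + j) = w k := by
    obtain ⟨k', hk', hw⟩ := ht.recurrent (w k) (k + 1)
    exact ⟨k' - (k + 1), by rw [Nat.add_sub_cancel' hk', hw]⟩
  have hconst : ∀ j ≤ Nat.find hex, A (k + 1 + j) (w k) = A (k + 1) (w k) := by
    intro j
    induction j with
    | zero => intro _; rfl
    | succ j ih =>
      intro hj
      rw [← ih (by omega), ← add_assoc]
      exact ht.idle _ _ (Ne.symm (Nat.find_min hex (Nat.lt_of_succ_le hj)))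
  have hgen : ∀ k' i, w k' = i → (LAM i (A k' i) : ℝ) ≤ hi := by
    rintro k' _ rfl
    exact ht.LAM_le k'
  have := hgen _ _ (Nat.find_spec hex)
  rwa [hconst _ le_rfl] at this

theorem dist_shared (ht : IsTrajectory f g r LA LM LAM γ w d A M Ahat Mhat lo hi τ)
    (hγ : ∀ k, 0 < γ k) (k : ℕ) : dist (M k) (M (k + 1)) = γ k * ‖Mhat k - M k‖ := by
  rw [dist_comm, dist_eq_norm, ht.update_master, add_sub_cancel_left, norm_smul, Real.norm_eq_abs,
    abs_of_pos (hγ k)]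

theorem dist_local (ht : IsTrajectory f g r LA LM LAM γ w d A M Ahat Mhat lo hi τ)
    (hγ : ∀ k, 0 < γ k) (k : ℕ) : dist (A k) (A (k + 1)) = γ k * ‖Ahat k - A k (w k)‖ := by
  have h : A (k + 1) - A k = PiLp.single 2 (w k) (γ k • (Ahat k - A k (w k))) := by
    ext1 i
    obtain rfl | hi := eq_or_ne i (w k)
    · rw [PiLp.sub_apply, ht.update_worker]
      simp
    · rw [PiLp.sub_apply, ht.idle k i hi]
      simp [hi]
  rw [dist_comm, dist_eq_norm, h, PiLp.norm_single, norm_smul, Real.norm_eq_abs, abs_of_pos (hγ k)]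

theorem stepEnergy_nonneg (hγ : ∀ k, 0 < γ k) (k : ℕ) : 0 ≤ stepEnergy γ w A M Ahat Mhat k := by
  have := hγ k
  unfold stepEnergy
  positivity

theorem dist_shared_le (ht : IsTrajectory f g r LA LM LAM γ w d A M Ahat Mhat lo hi τ)
    (hγ : ∀ k, 0 < γ k) (k : ℕ) :
    dist (M k) (M (k + 1)) ≤ γ k + stepEnergy γ w A M Ahat Mhat k := by
  rw [ht.dist_shared hγ, stepEnergy]
  nlinarith [mul_nonneg (hγ k).le (sq_nonneg (‖Mhat k - M k‖ - 1)),
    mul_nonneg (hγ k).le (sq_nonneg ‖Ahat k - A k (w k)‖),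
    mul_nonneg (hγ k).le (norm_nonneg (Mhat k - M k))]

theorem dist_local_le (ht : IsTrajectory f g r LA LM LAM γ w d A M Ahat Mhat lo hi τ)
    (hγ : ∀ k, 0 < γ k) (k : ℕ) :
    dist (A k) (A (k + 1)) ≤ γ k + stepEnergy γ w A M Ahat Mhat k := by
  rw [ht.dist_local hγ, stepEnergy]
  nlinarith [mul_nonneg (hγ k).le (sq_nonneg (‖Ahat k - A k (w k)‖ - 1)),
    mul_nonneg (hγ k).le (sq_nonneg ‖Mhat k - M k‖),
    mul_nonneg (hγ k).le (norm_nonneg (Ahat k - A k (w k)))]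

/-- One iteration keeps the iterates feasible and decreases the objective, up to an error caused by
the delay. -/
theorem step (hP : PALMAssumptions f g r LA LM)
    (hLAM : ∀ i X, LipschitzWith (LAM i X) (fun M => gradient (fun X' => f i X' M) X))
    (ht : IsTrajectory f g r LA LM LAM γ w d A M Ahat Mhat lo hi τ)
    (hγ : ∀ k, 0 < γ k) (hγ1 : ∀ k, γ k ≤ 1) {k : ℕ}
    (hA : ∀ i, g i (A k i) ≠ ⊤) (hM : r (M k) ≠ ⊤) :
    (∀ i, g i (A (k + 1) i) ≠ ⊤) ∧ r (M (k + 1)) ≠ ⊤ ∧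
      realObjective f g r (A (k + 1)) (M (k + 1)) ≤ realObjective f g r (A k) (M k)
        - lo * (1 - γ k) * stepEnergy γ w A M Ahat Mhat k
        + hi * dist (M k) (M (k - d k)) * (γ k * ‖Ahat k - A k (w k)‖) := by
  have hloA := ht.lo_pos.trans_le (ht.le_LA k)
  have hloM := ht.lo_pos.trans_le (ht.le_LM k)
  -- The step of the selected worker; its error is measured at the end point of the step.
  obtain ⟨hA', hAdec⟩ := (ht.prox_worker k).step_decrease (hP.g_convex (w k))
    (φ := fun X => f (w k) X (M k)) (e := hi * dist (M k) (M (k - d k)))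
    (hP.f_convex_left (w k) (M k)) hloA (hγ k).le (hγ1 k)
    (hasFDerivAt_left (hP.f_contDiff (w k)) _ _).differentiableAt (hA (w k)) (ht.update_worker k)
    (by
      rw [← dist_eq_norm, ← dist_eq_norm]
      refine (dist_triangle _ (gradient (fun X => f (w k) X (M (k - d k))) (A (k + 1) (w k)))
        _).trans ((add_le_add ?_ ?_).trans_eq (add_comm _ _))
      · exact ((hLAM (w k) (A (k + 1) (w k))).dist_le_mul (M k) (M (k - d k))).trans
          (mul_le_mul_of_nonneg_right (ht.LAM_next_le k) dist_nonneg)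
      · exact (hP.lipschitz_left (w k) (M (k - d k))).dist_le_mul _ _)
  -- The step of the master, which uses an exact gradient.
  obtain ⟨hM', hMdec⟩ := (ht.prox_master k).step_decrease hP.r_convex
    (φ := fun M => coupling f (A (k + 1)) M) (e := 0)
    (hP.convexOn_coupling (A (k + 1))) hloM (hγ k).le (hγ1 k)
    (hP.differentiableAt_coupling _ _) hM (ht.update_master k)
    (by
      rw [← dist_eq_norm, ← dist_eq_norm, add_zero]
      exact (hP.lipschitz_shared (A (k + 1))).dist_le_mul _ _)
  have hfin : ∀ i, g i (A (k + 1) i) ≠ ⊤ := by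
    intro i
    obtain rfl | hi := eq_or_ne i (w k)
    · exact hA'
    · rw [ht.idle k i hi]; exact hA i
  refine ⟨hfin, hM', ?_⟩
  have hf := sum_sub_sum_eq_single (a := fun i => f i (A (k + 1) i) (M k))
    (b := fun i => f i (A k i) (M k)) (w k) fun i hi => by rw [ht.idle k i hi]
  have hg := sum_sub_sum_eq_single (a := fun i => (g i (A (k + 1) i)).toReal)
    (b := fun i => (g i (A k i)).toReal) (w k) fun i hi => by rw [ht.idle k i hi]
  have hγ' : 0 ≤ γ k * (1 - γ k) := mul_nonneg (hγ k).le (sub_nonneg.mpr (hγ1 k))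
  have h1 := mul_le_mul_of_nonneg_right (ht.le_LA k)
    (mul_nonneg hγ' (sq_nonneg ‖Ahat k - A k (w k)‖))
  have h2 := mul_le_mul_of_nonneg_right (ht.le_LM k)
    (mul_nonneg hγ' (sq_nonneg ‖Mhat k - M k‖))
  simp only [realObjective, stepEnergy, coupling] at hMdec ⊢
  linarith

theorem feasible (hP : PALMAssumptions f g r LA LM)
    (hLAM : ∀ i X, LipschitzWith (LAM i X) (fun M => gradient (fun X' => f i X' M) X))
    (ht : IsTrajectory f g r LA LM LAM γ w d A M Ahat Mhat lo hi τ)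
    (hγ : ∀ k, 0 < γ k) (hγ1 : ∀ k, γ k ≤ 1) (k : ℕ) :
    (∀ i, g i (A k i) ≠ ⊤) ∧ r (M k) ≠ ⊤ := by
  induction k with
  | zero => exact ⟨ht.init_local, ht.init_shared⟩
  | succ k ih =>
    have := ht.step hP hLAM hγ hγ1 ih.1 ih.2
    exact ⟨this.1, this.2.1⟩

theorem summable_stepEnergy_and_tendsto (hP : PALMAssumptions f g r LA LM)
    (hLAM : ∀ i X, LipschitzWith (LAM i X) (fun M => gradient (fun X' => f i X' M) X))
    (ht : IsTrajectory f g r LA LM LAM γ w d A M Ahat Mhat lo hi τ)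
    (hγ : ∀ k, 0 < γ k) (hγ1 : ∀ k, γ k ≤ 1) (hzero : Tendsto γ atTop (𝓝 0)) :
    Summable (stepEnergy γ w A M Ahat Mhat) ∧
      ∃ l, Tendsto (fun k => realObjective f g r (A k) (M k)) atTop (𝓝 l) := by
  obtain ⟨b, hb⟩ := hP.objective_lower
  have hE := stepEnergy_nonneg (A := A) (M := M) (Ahat := Ahat) (Mhat := Mhat) hγ
  set E := stepEnergy γ w A M Ahat Mhat with hEdef
  have hlo := ht.lo_pos
  have hhi := ht.hi_pos
  have hsm : ∀ᶠ k in atTop, γ k * (lo + hi * τ) < lo / 2 := by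
    have := hzero.mul_const (lo + hi * τ)
    rw [zero_mul] at this
    exact this.eventually_lt_const (by positivity)
  obtain ⟨K, hK⟩ := eventually_atTop.mp hsm
  refine summable_and_tendsto_of_delayed_descent (b := b) (α := lo / 2) (β := hi / 2) (τ := τ)
    (K := max K τ) (z := fun k => γ k * E k) (fun k => ?_) (by positivity) (by positivity) hE
    (fun k => mul_nonneg (hγ k).le (hE k)) (fun k => mul_le_of_le_one_left (hE k) (hγ1 k))
    (fun k hk => ?_) (fun k hk => ?_)
  · obtain ⟨hA, hM⟩ := ht.feasible hP hLAM hγ hγ1 k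
    have := hb (WithLp.toLp 2 (A k, M k))
    rwa [hP.objective_eq_coe hA hM, EReal.coe_le_coe_iff] at this
  · have h1 := hK k (le_of_max_le_left hk)
    have h2 := mul_pos (hγ k) hlo
    have h3 : γ k * (hi * τ) * E k ≤ lo / 2 * E k :=
      mul_le_mul_of_nonneg_right (by linarith) (hE k)
    linarith
  · have h1 := hK k (le_of_max_le_left hk)
    obtain ⟨hA, hM⟩ := ht.feasible hP hLAM hγ hγ1 k
    obtain ⟨-, -, hdec⟩ := ht.step hP hLAM hγ hγ1 hA hM
    rw [← hEdef] at hdec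
    set a := γ k * ‖Ahat k - A k (w k)‖ with ha
    have ha0 : 0 ≤ a := mul_nonneg (hγ k).le (norm_nonneg _)
    have ha2 : a ^ 2 ≤ γ k * E k := by
      have := mul_nonneg (sq_nonneg (γ k)) (sq_nonneg ‖Mhat k - M k‖)
      rw [ha, hEdef, stepEnergy]
      linarith
    -- The delay error is absorbed by `x * y ≤ (x ^ 2 + y ^ 2) / 2`, once for each of the at most
    -- `τ` updates of the shared variable that the worker has not seen.
    have hdelay : dist (M k) (M (k - d k)) * a ≤
        (τ * (γ k * E k) + ∑ t ∈ Finset.range τ, γ (k - 1 - t) * E (k - 1 - t)) / 2 := by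
      have h2 : dist (M k) (M (k - d k)) ≤
          ∑ t ∈ Finset.range τ, dist (M (k - 1 - t)) (M (k - 1 - t + 1)) :=
        (dist_sub_le_sum M ((ht.delay_le k).trans (le_of_max_le_right hk))).trans
          (Finset.sum_le_sum_of_subset_of_nonneg (Finset.range_mono (ht.delay_le k))
            fun _ _ _ => dist_nonneg)
      refine (mul_le_mul_of_nonneg_right h2 ha0).trans ?_
      have h3 : (τ : ℝ) * (γ k * E k) = ∑ t ∈ Finset.range τ, γ k * E k := by simp
      rw [h3, ← Finset.sum_add_distrib, Finset.sum_mul, Finset.sum_div]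
      refine Finset.sum_le_sum fun t _ => ?_
      set j := k - 1 - t
      have h4 : dist (M j) (M (j + 1)) ^ 2 ≤ γ j * E j := by
        have := mul_nonneg (sq_nonneg (γ j)) (sq_nonneg ‖Ahat j - A j (w j)‖)
        rw [ht.dist_shared hγ, hEdef, stepEnergy]
        linarith
      nlinarith [sq_nonneg (dist (M j) (M (j + 1)) - a)]
    have h5 := mul_le_mul_of_nonneg_left hdelay hhi.le
    have h6 : γ k * (lo + hi * τ / 2) * E k ≤ lo / 2 * E k := by
      refine mul_le_mul_of_nonneg_right (le_trans ?_ h1.le) (hE k)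
      have : 0 ≤ hi * τ := by positivity
      exact mul_le_mul_of_nonneg_left (by linarith) (hγ k).le
    linarith

variable {p : Fin N → ℕ → ℝ} {T : ℕ} {pmin : ℝ}

/-- Every cluster point of a trajectory is critical, provided that the selections of each worker
follow, up to a convergent series, weights `p i` that reach `pmin` in every window. -/
theorem isCriticalPoint_of_mapClusterPt (hP : PALMAssumptions f g r LA LM)
    (ht : IsTrajectory f g r LA LM LAM γ w d A M Ahat Mhat lo hi τ)
    (hγ : ∀ k, 0 < γ k) (hanti : Antitone γ) (hzero : Tendsto γ atTop (𝓝 0))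
    (hdiv : ¬ Summable γ) (hE : Summable (stepEnergy γ w A M Ahat Mhat))
    (hp : ∀ i k, 0 ≤ p i k) (hpmin : 0 < pmin) (hwin : ∀ i k, ∃ t ≤ T, pmin ≤ p i (k + t))
    (hconv : ∀ i, ∃ l, Tendsto (fun n => ∑ k ∈ Finset.range n,
      γ k * ((if w k = i then 1 else 0) - p i k)) atTop (𝓝 l))
    {v : Joint L R n}
    (hv : MapClusterPt v atTop fun k => (WithLp.toLp 2 (A k, M k) : Joint L R n)) :
    IsCriticalPoint (objective f g r) v := by
  have hE0 := stepEnergy_nonneg (A := A) (M := M) (Ahat := Ahat) (Mhat := Mhat) hγ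
  set E := stepEnergy γ w A M Ahat Mhat with hEdef
  have hbound : Tendsto (fun k => γ k + E k) atTop (𝓝 0) := by
    simpa using hzero.add hE.tendsto_atTop_zero
  have hmoveA : Tendsto (fun k => dist (A k) (A (k + 1))) atTop (𝓝 0) :=
    squeeze_zero (fun _ => dist_nonneg) (ht.dist_local_le hγ) hbound
  have hmoveM : Tendsto (fun k => dist (M k) (M (k + 1))) atTop (𝓝 0) :=
    squeeze_zero (fun _ => dist_nonneg) (ht.dist_shared_le hγ) hbound
  have hdelay : Tendsto (fun k => dist (M k) (M (k - d k))) atTop (𝓝 0) := by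
    have h1 : Tendsto (fun k => ∑ t ∈ Finset.range τ, dist (M (k - 1 - t)) (M (k - 1 - t + 1)))
        atTop (𝓝 (∑ _t ∈ Finset.range τ, 0)) :=
      tendsto_finsetSum _ fun t _ =>
        hmoveM.comp ((tendsto_sub_atTop_nat t).comp (tendsto_sub_atTop_nat 1))
    rw [Finset.sum_const_zero] at h1
    refine squeeze_zero' (Eventually.of_forall fun _ => dist_nonneg) ?_ h1
    filter_upwards [eventually_ge_atTop τ] with k hk
    exact (dist_sub_le_sum M ((ht.delay_le k).trans hk)).trans
      (Finset.sum_le_sum_of_subset_of_nonneg (Finset.range_mono (ht.delay_le k))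
        fun _ _ _ => dist_nonneg)
  have hmove : ∀ k, dist (A k, M k) (A (k + 1), M (k + 1)) ≤ γ k + E k := fun k =>
    max_le (ht.dist_local_le hγ k) (ht.dist_shared_le hγ k)
  have hv' : MapClusterPt (v.fst, v.snd) atTop fun k => (A k, M k) :=
    hv.continuousAt_comp (f := fun v : Joint L R n => (v.fst, v.snd))
      (WithLp.prod_continuous_ofLp 2 _ _).continuousAt
  refine hP.isCriticalPoint ?_ ?_
  · intro i
    by_contra! hns
    obtain ⟨δ, hδ, hstep⟩ := exists_le_norm_prox_sub (hP.g_convex i) (H := hi)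
      (x' := v.fst i) (G' := gradient (fun X => f i X v.snd) (v.fst i))
      (by simpa only [not_le] using hns)
    obtain ⟨η, hη, hG⟩ := Metric.continuousAt_iff.mp
      ((continuous_gradient_left (hP.f_contDiff i)).continuousAt (x := (v.fst i, v.snd))) δ hδ
    refine not_mapClusterPt_of_summable_near (p := p i) (s := fun k => if w k = i then 1 else 0)
      (e' := fun k => (δ ^ 2)⁻¹ * E k) hanti (fun k => (hγ k).le) hzero hdiv (hp i) hpmin
      (hwin i) (hconv i) hE hE0 (hE.mul_left _)
      (fun k => mul_nonneg (by positivity) (hE0 k)) hmove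
      ⟨min δ (η / 2), lt_min hδ (half_pos hη), ?_⟩ hv'
    filter_upwards [hdelay.eventually_lt_const (half_pos hη)] with k hk hclose
    have hclose1 : dist (A k) v.fst < min δ (η / 2) := (le_max_left _ _).trans_lt hclose
    have hclose2 : dist (M k) v.snd < min δ (η / 2) := (le_max_right _ _).trans_lt hclose
    have hAi : dist (A k i) (v.fst i) < min δ (η / 2) :=
      (PiLp.dist_apply_le (A k) v.fst i).trans_lt hclose1
    have hMd : dist (M (k - d k)) v.snd < η := by
      have := dist_triangle_left (M (k - d k)) v.snd (M k)
      have := hclose2.trans_le (min_le_right _ _)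
      linarith
    have hGk : dist (gradient (fun X => f i X (M (k - d k))) (A k i))
        (gradient (fun X => f i X v.snd) (v.fst i)) < δ := by
      refine @hG (A k i, M (k - d k)) (max_lt ?_ hMd)
      have := hAi.trans_le (min_le_right _ _)
      change dist (A k i) (v.fst i) < η
      linarith
    split_ifs with hw
    · subst hw
      have h1 := hstep _ _ _ _ (hAi.trans_le (min_le_left _ _)) hGk
        (ht.lo_pos.trans_le (ht.le_LA k)) (ht.LA_le k) (ht.prox_worker k)
      have h2 : γ k * δ ^ 2 ≤ E k := by
        rw [hEdef, stepEnergy]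
        refine mul_le_mul_of_nonneg_left ?_ (hγ k).le
        have := pow_le_pow_left₀ hδ.le h1 2
        nlinarith [sq_nonneg ‖Mhat k - M k‖]
      rw [mul_one, inv_mul_eq_div, le_div_iff₀ (by positivity)]
      exact h2
    · rw [mul_zero]
      exact mul_nonneg (by positivity) (hE0 k)
  · by_contra! hns
    obtain ⟨δ, hδ, hstep⟩ := exists_le_norm_prox_sub hP.r_convex (H := hi)
      (x' := v.snd) (G' := gradient (fun M => coupling f v.fst M) v.snd)
      (by simpa only [not_le] using hns)
    obtain ⟨η, hη, hG⟩ := Metric.continuousAt_iff.mp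
      (hP.continuous_gradient_coupling.continuousAt (x := (v.fst, v.snd))) δ hδ
    -- The master acts at every iteration: all weights are equal to one.
    refine not_mapClusterPt_of_summable_near (p := fun _ => 1) (s := fun _ => 1) (T := 0)
      (pmin := 1) (e' := fun k => (δ ^ 2)⁻¹ * E k) hanti (fun k => (hγ k).le) hzero hdiv
      (fun _ => zero_le_one) one_pos (fun k => ⟨0, le_rfl, le_rfl⟩) ⟨0, by simp⟩ hE hE0
      (hE.mul_left _) (fun k => mul_nonneg (by positivity) (hE0 k)) hmove
      ⟨min δ (η / 2), lt_min hδ (half_pos hη), ?_⟩ hv'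
    filter_upwards [hmoveA.eventually_lt_const (half_pos hη)] with k hk hclose
    have hclose1 : dist (A k) v.fst < min δ (η / 2) := (le_max_left _ _).trans_lt hclose
    have hclose2 : dist (M k) v.snd < min δ (η / 2) := (le_max_right _ _).trans_lt hclose
    have hGk : dist (gradient (fun M => coupling f (A (k + 1)) M) (M k))
        (gradient (fun M => coupling f v.fst M) v.snd) < δ := by
      refine @hG (A (k + 1), M k) (max_lt ?_ ?_)
      · have := dist_triangle_left (A (k + 1)) v.fst (A k)
        have := hclose1.trans_le (min_le_right _ _)
        change dist (A (k + 1)) v.fst < η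
        linarith
      · have := hclose2.trans_le (min_le_right _ _)
        change dist (M k) v.snd < η
        linarith
    have h1 := hstep _ _ _ _ (hclose2.trans_le (min_le_left _ _)) hGk
      (ht.lo_pos.trans_le (ht.le_LM k)) (ht.LM_le k) (ht.prox_master k)
    have h2 : γ k * δ ^ 2 ≤ E k := by
      rw [hEdef, stepEnergy]
      refine mul_le_mul_of_nonneg_left ?_ (hγ k).le
      have := pow_le_pow_left₀ hδ.le h1 2
      nlinarith [sq_nonneg ‖Ahat k - A k (w k)‖]
    rw [mul_one, inv_mul_eq_div, le_div_iff₀ (by positivity)]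
    exact h2

end IsTrajectory

/-- Weights that reach `pmin` in every window force infinitely many selections. -/
theorem exists_ge_eq_of_window {p : ℕ → ℝ} {T : ℕ} {pmin : ℝ} {i : Fin N}
    (hγ : ∀ k, 0 < γ k) (hanti : Antitone γ) (hzero : Tendsto γ atTop (𝓝 0))
    (hdiv : ¬ Summable γ) (hp : ∀ k, 0 ≤ p k) (hpmin : 0 < pmin)
    (hwin : ∀ k, ∃ t ≤ T, pmin ≤ p (k + t))
    (hconv : ∃ l, Tendsto (fun n => ∑ k ∈ Finset.range n,
      γ k * ((if w k = i then 1 else 0) - p k)) atTop (𝓝 l)) (k : ℕ) : ∃ k' ≥ k, w k' = i := by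
  by_contra! hne
  -- A constant sequence clusters at its value; without selections after `k` this is excluded.
  refine not_mapClusterPt_of_summable_near (X := Unit) (v := fun _ => ()) (c := ()) (e := 0)
    (e' := 0) hanti (fun k => (hγ k).le) hzero hdiv hp hpmin hwin hconv summable_zero
    (fun _ => le_rfl) summable_zero (fun _ => le_rfl) (fun k => by simpa using (hγ k).le)
    ⟨1, one_pos, ?_⟩ (tendsto_const_nhds.mapClusterPt)
  filter_upwards [eventually_ge_atTop k] with k' hk' _
  simp [hne k' hk']

end Trajectory

end AsyncUnmixing

theorem proposition1
    {N L R : ℕ} {n : Fin N → ℕ}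
    -- the problem
    (f : ∀ i, RMat R (n i) → RMat L R → ℝ) (g : ∀ i, RMat R (n i) → EReal)
    (r : RMat L R → EReal)
    -- partial Lipschitz constants and regularity
    (LA : Fin N → RMat L R → ℝ≥0) (LM : Locals R n → ℝ≥0)
    (LAM : ∀ i, RMat R (n i) → ℝ≥0)
    (hPALM : PALMAssumptions f g r LA LM)
    (hLAM : ∀ i X, LipschitzWith (LAM i X) (fun M => gradient (fun X' => f i X' M) X))
    -- random workers and delays
    {Ω : Type*} [MeasurableSpace Ω] (P : Measure Ω) [IsProbabilityMeasure P]
    (w : ℕ → Ω → Fin N) (d : ℕ → Ω → ℕ) (hmodel : DelayModel P w d)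
    -- relaxation parameters
    (γ : ℕ → ℝ) (μ : ℝ) (hγ0 : 0 < γ 0) (hγ0' : γ 0 ≤ 1) (hμ0 : 0 < μ) (hμ1 : μ < 1)
    (hγ : ∀ k, γ (k + 1) = γ k * (1 - μ * γ k))
    -- feasible initial point
    (A0 : Locals R n) (M0 : RMat L R)
    (hA0 : ∀ i, g i (A0 i) ≠ ⊤) (hM0 : r M0 ≠ ⊤)
    -- the iterates, with step-size parameters equal to the partial Lipschitz constants
    (A : ℕ → Ω → Locals R n) (M : ℕ → Ω → RMat L R)
    (hrun : ∀ᵐ x ∂P, IsRun f g r γ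
      (fun k => (LA (w k x) (M (k - d k x) x) : ℝ)) (fun k => (LM (A (k + 1) x) : ℝ))
      A0 M0 (fun k => w k x) (fun k => d k x) (fun k => A k x) (fun k => M k x))
    -- boundedness of the Lipschitz constants along the iterates
    (hLA_bdd : ∀ᵐ x ∂P, ∃ lo hi : ℝ, 0 < lo ∧ ∀ k,
      lo ≤ (LA (w k x) (M (k - d k x) x) : ℝ) ∧ (LA (w k x) (M (k - d k x) x) : ℝ) ≤ hi)
    (hLM_bdd : ∀ᵐ x ∂P, ∃ lo hi : ℝ, 0 < lo ∧ ∀ k,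
      lo ≤ (LM (A (k + 1) x) : ℝ) ∧ (LM (A (k + 1) x) : ℝ) ≤ hi)
    (hLAM_bdd : ∀ᵐ x ∂P, ∃ lo hi : ℝ, 0 < lo ∧ ∀ k,
      lo ≤ (LAM (w k x) (A k x (w k x)) : ℝ) ∧ (LAM (w k x) (A k x (w k x)) : ℝ) ≤ hi) :
    (∀ᵐ x ∂P, ∃ l : ℝ,
      Tendsto (fun k => objective f g r (WithLp.toLp 2 (A k x, M k x))) atTop
        (𝓝 (l : EReal))) ∧
    (∀ᵐ x ∂P, ∀ v : Joint L R n,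
      MapClusterPt v atTop (fun k => (WithLp.toLp 2 (A k x, M k x) : Joint L R n)) →
        IsCriticalPoint (objective f g r) v) := by
  have hpos1 := relaxation_pos_le_one hγ0 hγ0' hμ0 hμ1 hγ
  have hpos : ∀ k, 0 < γ k := fun k => (hpos1 k).1
  have hle1 : ∀ k, γ k ≤ 1 := fun k => (hpos1 k).2
  have hanti := relaxation_antitone hpos hμ0 hγ
  have hzero := relaxation_tendsto_zero hpos hμ0 hγ
  have hdiv := relaxation_not_summable hpos hμ0 hγ
  have hsq := relaxation_summable_sq hpos hμ0 hγ
  obtain ⟨τ, -, hτ⟩ := hmodel.bounded_delay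
  obtain ⟨T, pmin, hpmin, hsel⟩ := hmodel.selection
  have hmart := ae_all_iff.mpr fun i => hmodel.ae_tendsto_sum (fun k => (hpos k).le) hsq i
  rw [← eventually_and]
  filter_upwards [hrun, hLA_bdd, hLM_bdd, hLAM_bdd, hτ, hsel, hmart] with x hx
    ⟨lo₁, hi₁, hlo₁, h₁⟩ ⟨lo₂, hi₂, hlo₂, h₂⟩ ⟨lo₃, hi₃, _, h₃⟩ hd hwin hconv
  have hp : ∀ i k, 0 ≤ (P[|history w d k x]).real {y | w k y = i} := fun _ _ => measureReal_nonneg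
  have hwin' : ∀ i k, ∃ t ≤ T,
      pmin ≤ (P[|history w d (k + t) x]).real {y | w (k + t) y = i} := fun i k => hwin k i
  choose Ahat hAhat hAupd using hx.worker
  choose Mhat hMhat hMupd using hx.master
  have ht : IsTrajectory f g r LA LM LAM γ (fun k => w k x) (fun k => d k x) (fun k => A k x)
      (fun k => M k x) Ahat Mhat (min lo₁ lo₂) (max hi₁ (max hi₂ hi₃)) τ :=
    { init_local := fun i => by rw [hx.init_local]; exact hA0 i
      init_shared := by rw [hx.init_shared]; exact hM0
      prox_worker := hAhat
      update_worker := hAupd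
      idle := hx.idle
      prox_master := hMhat
      update_master := hMupd
      lo_pos := lt_min hlo₁ hlo₂
      le_LA := fun k => (min_le_left _ _).trans (h₁ k).1
      LA_le := fun k => (h₁ k).2.trans (le_max_left _ _)
      le_LM := fun k => (min_le_right _ _).trans (h₂ k).1
      LM_le := fun k => (h₂ k).2.trans ((le_max_left _ _).trans (le_max_right _ _))
      LAM_le := fun k => (h₃ k).2.trans ((le_max_right _ _).trans (le_max_right _ _))
      delay_le := hd
      recurrent := fun i => exists_ge_eq_of_window (γ := γ) hpos hanti hzero hdiv (hp i) hpmin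
        (hwin' i) (hconv i) }
  obtain ⟨hE, l, hl⟩ := ht.summable_stepEnergy_and_tendsto hPALM hLAM hpos hle1 hzero
  refine ⟨⟨l, ?_⟩, fun v hv => ?_⟩
  · refine ((continuous_coe_real_ereal.tendsto l).comp hl).congr fun k => ?_
    obtain ⟨hA, hM⟩ := ht.feasible hPALM hLAM hpos hle1 k
    exact (hPALM.objective_eq_coe hA hM).symm
  · exact ht.isCriticalPoint_of_mapClusterPt hPALM hpos hanti hzero hdiv hE hp hpmin hwin' hconv hv
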